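/- Let $n\ge 2$, let $U\subseteq\mathbb R^n$ be a connected coordinate domain, and let $g$ be a flat smooth Riemannian metric on $U$ (i.e. locally isometric to Euclidean space) with Levi-Civita connection $\nabla$. Let $\star$ be a Hesse-Frobenius structure for $g$: a smooth commutative associative product of vector fields (bilinear over functions) such that $g(X\star Y,Z)=g(X,Y\star Z)$ and $(\nabla_Z\star)(X,Y)=X\star Y\star Z$. Assume that it is semi-simple in the sense that every tangent space has a basis $(e_i)$ with $e_i\star e_j=0$ for $i\ne j$ and $e_i\star e_i\in\{e_i,0\}$. Let $C_{ijk}=g(\partial_i\star\partial_j,\partial_k)$. The three-step procedure is as follows. (1) Put $T_{ijk}=3\left(C_{ijk}-\frac1n g_{ij}g^{ab}C_{abk}\right)$ and $\hat T^k_{ij}=T_{ija}g^{ak}$. (2) Find the general smooth solution $V$ of $\nabla^2_{ij}V=\hat T^k_{ij}\partial_kV+\frac1n g_{ij}\Delta V$. (3) Find the Killing tensors $K_{ij}$ of $g$ for which the part of $\left(\nabla_jK^a_i+K^b_i\hat T^a_{bj}\right)\partial_aV$ that is skew-symmetric in $i,j$ vanishes for every solution $V$ of (2). Then there is an integer $m$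 with $0\le m\le n$ such that every point of $U$ has a neighbourhood in $U$ with smooth coordinates $(x_1,\dots,x_n)$, ranging over a connected open set $O\subseteq\mathbb R^n$ on which $x_j\neq0$ for $j>m$, in which $$g_{ij}=\delta_{ij},\qquad C_{ijk}=\lambda_i\,\delta_{ij}\delta_{jk},\qquad \lambda_j=0\ (j\le m),\qquad \lambda_j=-\frac1{x_j}\ (j>m),$$ and in which the procedure gives the following. (a) The solutions on $O$ of the equation in (2) are exactly the functions $$V=c_0\Big(4\sum_{j\le m}x_j^2+\sum_{j>m}x_j^2\Big)+\sum_{j\le m}c_jx_j+\sum_{j>m}\frac{c_j}{x_j^2}+c_{n+1},\qquad c_0,\dots,c_{n+1}\in\mathbb R .$$ (b) For all values of the parameters, the (generalized Smorodinski-Winternitz) Hamiltonian $H=\sum_ip_i^2+V$ is second-order maximally superintegrable on $O\times\mathbb R^n$: there are $2n-2$ functions $F^{(k)}=K^{(k)\,ij}(x)p_ip_j+W^{(k)}(x)$, with $K^{(k)}$ and $W^{(k)}$ smooth and $K^{(k)}$ symmetric, that Poisson commute with $H$ and for which $H,F^{(1)},\dots,F^{(2n-2)}$ are functionally independent (their differentials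 are linearly independent on a dense subset of $O\times\mathbb R^n$). (c) Unless $m=n$ and $V$ is constant, the functions $F^{(k)}$ in (b) can be chosen such that all $K^{(k)}$ are solutions of step (3). -/

import Mathlib

open scoped ContDiff Matrix

namespace HesseFrobenius

noncomputable section

/-- Coordinate space: points `x = (x₁, …, xₙ)`, tangent vectors and covectors at a point. -/
abbrev Coord (n : ℕ) : Type := Fin n → ℝ

/-- A `(0,2)`-tensor field in coordinates, `x ↦ (K i j (x))`. -/
abbrev TwoTensor (n : ℕ) : Type := Coord n → Matrix (Fin n) (Fin n) ℝ

/-- A product of vector fields (a `(1,2)`-tensor field): a bilinear product on each tangent space. -/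
abbrev Product (n : ℕ) : Type := Coord n → (Coord n →ₗ[ℝ] Coord n →ₗ[ℝ] Coord n)

/-- The coordinate vector field `∂/∂xᵢ`. -/
def ev {n : ℕ} (i : Fin n) : Coord n := Pi.single i 1

/-- The partial derivative `∂f/∂xᵢ`. -/
def pd {n : ℕ} (i : Fin n) (f : Coord n → ℝ) (x : Coord n) : ℝ := fderiv ℝ f x (ev i)

/-- A smooth Riemannian metric on `U`, given by its components `g i j`. -/
structure IsRiemannianMetric {n : ℕ} (U : Set (Coord n)) (g : TwoTensor n) : Prop where
  smooth : ∀ i j, ContDiffOn ℝ ∞ (fun x => g x i j) U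
  posDef : ∀ x ∈ U, (g x).PosDef

/-- The metric `g i j = δ i j`. -/
def euclid (n : ℕ) : TwoTensor n := fun _ => 1

/-- A smooth change of coordinates from `Φ.source` to `Φ.target`. -/
structure IsCoordChange {n : ℕ} (Φ : OpenPartialHomeomorph (Coord n) (Coord n)) : Prop where
  smooth : ContDiffOn ℝ ∞ Φ Φ.source
  smooth_symm : ContDiffOn ℝ ∞ Φ.symm Φ.target

/-- In the new coordinates `y = Φ x` the metric `g` has the components `g'`. -/
def TransformsMetric {n : ℕ} (Φ : OpenPartialHomeomorph (Coord n) (Coord n))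
    (g g' : TwoTensor n) : Prop :=
  ∀ x ∈ Φ.source, ∀ X Y : Coord n,
    X ⬝ᵥ (g x *ᵥ Y) = (fderiv ℝ Φ x X) ⬝ᵥ (g' (Φ x) *ᵥ (fderiv ℝ Φ x Y))

/-- In the new coordinates `y = Φ x` the product `star` of vector fields becomes `star'`. -/
def TransformsProduct {n : ℕ} (Φ : OpenPartialHomeomorph (Coord n) (Coord n))
    (star star' : Product n) : Prop :=
  ∀ x ∈ Φ.source, ∀ X Y : Coord n,
    fderiv ℝ Φ x (star x X Y) = star' (Φ x) (fderiv ℝ Φ x X) (fderiv ℝ Φ x Y)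

/-- A Riemannian metric is flat if it is locally isometric to Euclidean space. -/
def IsFlat {n : ℕ} (U : Set (Coord n)) (g : TwoTensor n) : Prop :=
  ∀ p ∈ U, ∃ Φ : OpenPartialHomeomorph (Coord n) (Coord n),
    IsCoordChange Φ ∧ p ∈ Φ.source ∧ Φ.source ⊆ U ∧ TransformsMetric Φ g (euclid n)

/-- The Christoffel symbols `Γᵏᵢⱼ` of the Levi-Civita connection of `g`. -/
def christoffel {n : ℕ} (g : TwoTensor n) (k i j : Fin n) (x : Coord n) : ℝ :=
  (1 / 2) * ∑ l, (g x)⁻¹ k l *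
    (pd i (fun y => g y j l) x + pd j (fun y => g y i l) x - pd l (fun y => g y i j) x)

/-- The components `(∂ᵢ ⋆ ∂ⱼ)ᵏ` of the product. -/
def coeff {n : ℕ} (star : Product n) (k i j : Fin n) (x : Coord n) : ℝ :=
  star x (ev i) (ev j) k

/-- The components `(∇ₗ ⋆)ᵏᵢⱼ` of the covariant derivative of the product. -/
def covDerivProduct {n : ℕ} (g : TwoTensor n) (star : Product n) (l k i j : Fin n)
    (x : Coord n) : ℝ :=
  pd l (coeff star k i j) x
    + ∑ a, christoffel g k l a x * coeff star a i j x
    - ∑ a, christoffel g a l i x * coeff star k a j x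
    - ∑ a, christoffel g a l j x * coeff star k i a x

/-- A Hesse-Frobenius structure on `U` for the metric `g`: a smooth commutative and associative
product of vector fields with `g(X ⋆ Y, Z) = g(X, Y ⋆ Z)` and `(∇_Z ⋆)(X, Y) = X ⋆ Y ⋆ Z`. -/
structure IsHesseFrobenius {n : ℕ} (U : Set (Coord n)) (g : TwoTensor n) (star : Product n) :
    Prop where
  smooth : ∀ k i j, ContDiffOn ℝ ∞ (coeff star k i j) U
  comm : ∀ x ∈ U, ∀ X Y, star x X Y = star x Y X
  assoc : ∀ x ∈ U, ∀ X Y Z, star x (star x X Y) Z = star x X (star x Y Z)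
  frobenius : ∀ x ∈ U, ∀ X Y Z, star x X Y ⬝ᵥ (g x *ᵥ Z) = X ⬝ᵥ (g x *ᵥ star x Y Z)
  differential : ∀ x ∈ U, ∀ l k i j,
    covDerivProduct g star l k i j x = star x (star x (ev i) (ev j)) (ev l) k

/-- Semi-simplicity: every tangent algebra is a direct sum of one-dimensional ideals, i.e. it has
a basis with `eᵢ ⋆ eⱼ = 0` for `i ≠ j` and with each `eᵢ ⋆ eᵢ` equal to `eᵢ` or to `0`. -/
def IsSemiSimple {n : ℕ} (U : Set (Coord n)) (star : Product n) : Prop :=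
  ∀ x ∈ U, ∃ e : Module.Basis (Fin n) ℝ (Coord n),
    (∀ i j, i ≠ j → star x (e i) (e j) = 0) ∧
    ∀ i, star x (e i) (e i) = e i ∨ star x (e i) (e i) = 0

/-! Step 1: the structure tensor. -/

/-- `C i j k = g(∂ᵢ ⋆ ∂ⱼ, ∂ₖ)`. -/
def cubic {n : ℕ} (g : TwoTensor n) (star : Product n) (i j k : Fin n) (x : Coord n) : ℝ :=
  star x (ev i) (ev j) ⬝ᵥ (g x *ᵥ ev k)

/-- `T i j k = 3 (C i j k - (1/n) g i j gᵃᵇ C a b k)`. -/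
def structureTensor {n : ℕ} (g : TwoTensor n) (star : Product n) (i j k : Fin n)
    (x : Coord n) : ℝ :=
  3 * (cubic g star i j k x
    - (1 / (n : ℝ)) * g x i j * ∑ a, ∑ b, (g x)⁻¹ a b * cubic g star a b k x)

/-- `T̂ᵏᵢⱼ = T i j a gᵃᵏ`. -/
def structureTensorHat {n : ℕ} (g : TwoTensor n) (star : Product n) (k i j : Fin n)
    (x : Coord n) : ℝ :=
  ∑ a, structureTensor g star i j a x * (g x)⁻¹ a k

/-! Step 2: the potential. -/

/-- The Hessian `∇²ᵢⱼ V`. -/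
def hessian {n : ℕ} (g : TwoTensor n) (V : Coord n → ℝ) (i j : Fin n) (x : Coord n) : ℝ :=
  pd i (pd j V) x - ∑ k, christoffel g k i j x * pd k V x

/-- The Laplace-Beltrami operator, the `g`-trace of the Hessian. -/
def laplacian {n : ℕ} (g : TwoTensor n) (V : Coord n → ℝ) (x : Coord n) : ℝ :=
  ∑ a, ∑ b, (g x)⁻¹ a b * hessian g V a b x

/-- `V` is a smooth solution on `U` of `∇²ᵢⱼ V = T̂ᵏᵢⱼ ∂ₖ V + (1/n) g i j Δ V`. -/
def SolvesPotentialEq {n : ℕ} (U : Set (Coord n)) (g : TwoTensor n) (star : Product n)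
    (V : Coord n → ℝ) : Prop :=
  ContDiffOn ℝ ∞ V U ∧ ∀ x ∈ U, ∀ i j,
    hessian g V i j x =
      ∑ k, structureTensorHat g star k i j x * pd k V x + (1 / (n : ℝ)) * g x i j * laplacian g V x

/-! Step 3: the Killing tensors. -/

/-- The covariant derivative `∇ₗ Kᵢⱼ` of a `(0,2)`-tensor. -/
def covDeriv {n : ℕ} (g K : TwoTensor n) (l i j : Fin n) (x : Coord n) : ℝ :=
  pd l (fun y => K y i j) x
    - ∑ a, christoffel g a l i x * K x a j
    - ∑ a, christoffel g a l j x * K x i a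

/-- A smooth symmetric `(0,2)`-tensor field on `U`. -/
structure IsSymTensor {n : ℕ} (U : Set (Coord n)) (K : TwoTensor n) : Prop where
  smooth : ∀ i j, ContDiffOn ℝ ∞ (fun x => K x i j) U
  symm : ∀ x ∈ U, (K x).IsSymm

/-- A Killing tensor of `g` on `U`. -/
structure IsKilling {n : ℕ} (U : Set (Coord n)) (g K : TwoTensor n) : Prop
    extends IsSymTensor U K where
  killing : ∀ x ∈ U, ∀ i j l,
    covDeriv g K l i j x + covDeriv g K i j l x + covDeriv g K j l i x = 0

/-- The components `Kᵃᵢ`. -/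
def mixed {n : ℕ} (g K : TwoTensor n) (a i : Fin n) (x : Coord n) : ℝ :=
  ∑ b, (g x)⁻¹ a b * K x b i

/-- The components `Kᵃᵢ,ⱼ = ∇ⱼ Kᵃᵢ`. -/
def covDerivMixed {n : ℕ} (g K : TwoTensor n) (a i j : Fin n) (x : Coord n) : ℝ :=
  ∑ b, (g x)⁻¹ a b * covDeriv g K j b i x

/-- The compatibility (Bertrand-Darboux) condition `(Kᵃᵢ,ⱼ + Kᵇᵢ T̂ᵃ_bⱼ) ∂ₐ V = 0`, skew-symmetrised
in `i, j`. -/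
def BertrandDarboux {n : ℕ} (U : Set (Coord n)) (g : TwoTensor n) (star : Product n)
    (K : TwoTensor n) (V : Coord n → ℝ) : Prop :=
  ∀ x ∈ U, ∀ i j, ∑ a,
    ((covDerivMixed g K a i j x - covDerivMixed g K a j i x)
      + ∑ b, (mixed g K b i x * structureTensorHat g star a b j x
          - mixed g K b j x * structureTensorHat g star a b i x)) * pd a V x = 0

/-- The outcome of the third step: Killing tensors that satisfy the compatibility condition with
all potentials obtained in the second step. -/
def IsCompatibleKilling {n : ℕ} (U : Set (Coord n)) (g : TwoTensor n) (star : Product n)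
    (K : TwoTensor n) : Prop :=
  IsKilling U g K ∧ ∀ V, SolvesPotentialEq U g star V → BertrandDarboux U g star K V

/-! Superintegrability. -/

/-- The canonical Poisson bracket on phase space, with points `(x, p)`. -/
def poisson {n : ℕ} (F H : Coord n × Coord n → ℝ) (z : Coord n × Coord n) : ℝ :=
  ∑ j, (fderiv ℝ F z (ev j, 0) * fderiv ℝ H z (0, ev j)
    - fderiv ℝ H z (ev j, 0) * fderiv ℝ F z (0, ev j))

/-- The natural Hamiltonian `H(x, p) = gⁱʲ(x) pᵢ pⱼ + V(x)`. -/
def hamiltonian {n : ℕ} (g : TwoTensor n) (V : Coord n → ℝ) (z : Coord n × Coord n) : ℝ :=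
  z.2 ⬝ᵥ ((g z.1)⁻¹ *ᵥ z.2) + V z.1

/-- The function `F(x, p) = Kⁱʲ(x) pᵢ pⱼ + W(x)`, where the indices of `K` are raised with `g`. -/
def quadratic {n : ℕ} (g K : TwoTensor n) (W : Coord n → ℝ) (z : Coord n × Coord n) : ℝ :=
  z.2 ⬝ᵥ (((g z.1)⁻¹ * K z.1 * (g z.1)⁻¹) *ᵥ z.2) + W z.1

/-- Functional independence on `P`: the differentials are linearly independent on a dense subset
of `P` (which is relatively open for smooth functions). -/
def FunctionallyIndependent {n : ℕ} {ι : Type*} (P : Set (Coord n × Coord n))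
    (F : ι → Coord n × Coord n → ℝ) : Prop :=
  P ⊆ closure {z ∈ P | LinearIndependent ℝ (fun i => fderiv ℝ (F i) z)}

/-- The functions `F⁽ᵏ⁾ = Kⁱʲpᵢpⱼ + W` given by `K k` and `W k`, for `k = 1, …, 2n-2`, make the
natural Hamiltonian with potential `V` a second-order maximally superintegrable system on the phase
space over `U`. -/
structure IsSuperintegrableWith {n : ℕ} (U : Set (Coord n)) (g : TwoTensor n) (V : Coord n → ℝ)
    (K : Fin (2 * n - 2) → TwoTensor n) (W : Fin (2 * n - 2) → Coord n → ℝ) : Prop where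
  tensor : ∀ k, IsSymTensor U (K k)
  smooth : ∀ k, ContDiffOn ℝ ∞ (W k) U
  commute : ∀ k, ∀ z ∈ U ×ˢ (Set.univ : Set (Coord n)),
    poisson (quadratic g (K k) (W k)) (hamiltonian g V) z = 0
  independent : FunctionallyIndependent (U ×ˢ (Set.univ : Set (Coord n)))
    (fun o : Option (Fin (2 * n - 2)) =>
      o.elim (hamiltonian g V) (fun k => quadratic g (K k) (W k)))

/-- The natural Hamiltonian with potential `V` is second-order maximally superintegrable. -/
def IsSuperintegrable {n : ℕ} (U : Set (Coord n)) (g : TwoTensor n) (V : Coord n → ℝ) : Prop :=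
  ∃ K W, IsSuperintegrableWith U g V K W

/-! The normal form. -/

/-- The product `∂ᵢ ⋆ ∂ⱼ = λᵢ δᵢⱼ ∂ᵢ`. -/
def diagProduct {n : ℕ} (lam : Fin n → Coord n → ℝ) : Product n := fun y =>
  LinearMap.mk₂ ℝ (fun X Y i => lam i y * X i * Y i)
    (fun X X' Y => by ext i; simp only [Pi.add_apply]; ring)
    (fun c X Y => by ext i; simp only [Pi.smul_apply, smul_eq_mul]; ring)
    (fun X Y Y' => by ext i; simp only [Pi.add_apply]; ring)
    (fun c X Y => by ext i; simp only [Pi.smul_apply, smul_eq_mul]; ring)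

/-- `λⱼ = 0` for the first `m` coordinates, `λⱼ = -1/yⱼ` for the others. -/
def normalLam {n : ℕ} (m : ℕ) (j : Fin n) (y : Coord n) : ℝ :=
  if j.val < m then 0 else -(1 / y j)

/-- The generalized Smorodinski-Winternitz potential with parameters `c₀`, `c₁, …, cₙ` (the entries
of `c`) and `cₙ₊₁` (called `d`). -/
def swPotential {n : ℕ} (m : ℕ) (c₀ : ℝ) (c : Fin n → ℝ) (d : ℝ) (y : Coord n) : ℝ :=
  c₀ * (4 * (∑ j with j.val < m, y j ^ 2) + ∑ j with ¬ j.val < m, y j ^ 2)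
    + (∑ j with j.val < m, c j * y j) + (∑ j with ¬ j.val < m, c j / y j ^ 2) + d

end

end HesseFrobenius

namespace HesseFrobenius

variable {n : ℕ}

/-! Calculus in Cartesian coordinates. -/

/-! The local structure is rigid. In flat coordinates the structure equation reads `D_Z ⋆ (X, Y) = X
⋆ Y ⋆ Z` (`fderiv_pushProduct`), a first-order equation whose right-hand side is quadratic in the
product. Grönwall's inequality along segments then shows that two solutions on a convex set which
agree at one point are equal (`eqOn_of_fderiv_eq_mul`). At one point, Frobenius symmetry makes the
idempotents mutually orthogonal, so a rotation diagonalises the product with eigenvalues `μᵢ`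
(`exists_orthogonal_diagonal`). A translation moves that point to the coordinates `-1/μⱼ` where `μⱼ
≠ 0`. There the diagonal product with `λ = -1/x`, which solves `λ' = λ²`, has the same value, so the
two products coincide nearby (`exists_normalForm`). The integer `m` is the dimension of the
annihilator of the tangent algebra (`finrank_ker_eq`); it is locally constant, hence constant on the
connected set `U`.

In the normal form the potential equation separates: mixed second derivatives vanish and `∂ᵢ²V -
3λᵢ∂ᵢV` does not depend on `i`. With at least two indices this common value is constant, and the
resulting linear equation for each `∂ᵢV` integrates to the stated family
(`solvesPotentialEq_normalLam_iff`).

For the integrals, write `V` as a sum of functions `Vᵢ(xᵢ)` and fix an index `j`. Each `i ≠ j`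
contributes `pᵢ² + Vᵢ(xᵢ)` and one further integral linking `i` to `j`; together with `H` this gives
`2n - 1` functions. If `m < n`, `j` is a singular index and the links have leading part `pⱼ(xᵢpⱼ -
xⱼpᵢ)` for `i` regular and `(xᵢpⱼ - xⱼpᵢ)²` for `i` singular. If `m = n` and `V` is not constant,
`j` is chosen with `Vⱼ` not constant and the links are `pᵢpⱼ`. The free particle uses `pⱼ(xᵢpⱼ -
xⱼpᵢ)`, giving up compatibility. Independence reduces to one 2 × 2 Jacobian in `(xᵢ, pᵢ)` for each
`i` (`linearIndependent_option_sum`), and these Jacobians are nonzero polynomials of degree at most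
three along well-chosen lines, hence nonzero on a dense set (`isSuperintegrableWith_of_isLink`). -/

@[simp]
theorem ev_apply (i j : Fin n) : (ev i : Coord n) j = if j = i then 1 else 0 := by
  simp [ev, Pi.single_apply]

theorem euclid_apply (x : Coord n) : euclid n x = 1 := rfl

@[simp]
theorem christoffel_euclid (k i j : Fin n) (x : Coord n) : christoffel (euclid n) k i j x = 0 := by
  simp [christoffel, euclid, pd]

@[simp]
theorem hessian_euclid (V : Coord n → ℝ) (i j : Fin n) (x : Coord n) :
    hessian (euclid n) V i j x = pd i (pd j V) x := by
  simp [hessian]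

@[simp]
theorem laplacian_euclid (V : Coord n → ℝ) (x : Coord n) :
    laplacian (euclid n) V x = ∑ a, pd a (pd a V) x := by
  simp [laplacian, euclid, Matrix.one_apply]

@[simp]
theorem diagProduct_apply (lam : Fin n → Coord n → ℝ) (y X Y : Coord n) (i : Fin n) :
    diagProduct lam y X Y i = lam i y * X i * Y i := rfl

theorem cubic_diagProduct (lam : Fin n → Coord n → ℝ) (i j k : Fin n) (x : Coord n) :
    cubic (euclid n) (diagProduct lam) i j k x = if i = j ∧ j = k then lam k x else 0 := by
  simp only [cubic, euclid, Matrix.one_mulVec, dotProduct, diagProduct_apply, ev_apply]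
  rw [Finset.sum_eq_single k]
  · by_cases hj : j = k
    · by_cases hi : i = k <;> simp [hi, hj, eq_comm]
    · simp [hj, eq_comm]
  · intro b _ hb; simp [hb]
  · simp

theorem structureTensorHat_diagProduct (lam : Fin n → Coord n → ℝ) (k i j : Fin n) (x : Coord n) :
    structureTensorHat (euclid n) (diagProduct lam) k i j x =
      if i = j then 3 * ((if i = k then lam k x else 0) - 1 / (n : ℝ) * lam k x) else 0 := by
  have h : ∀ c, ∑ a, ∑ b, (1 : Matrix (Fin n) (Fin n) ℝ) a b *
      (if a = b ∧ b = c then lam c x else 0) = lam c x := by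
    intro c
    simp only [Matrix.one_apply, ite_mul, one_mul, zero_mul, Finset.sum_ite_eq, Finset.mem_univ,
      if_true, true_and, Finset.sum_ite_eq']
  simp only [structureTensorHat, structureTensor, cubic_diagProduct, euclid_apply, inv_one, h]
  rw [Finset.sum_eq_single k]
  · by_cases hij : i = j
    · subst hij
      simp
    · simp [hij]
  · intro b _ hb; simp [Matrix.one_apply_ne hb]
  · simp

/-- The potential equation for a diagonal product in Cartesian coordinates: the mixed second
derivatives vanish and `∂ᵢ²V - 3 λᵢ ∂ᵢV` does not depend on `i`. -/
theorem solvesPotentialEq_diagProduct_iff (hn : n ≠ 0) (O : Set (Coord n))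
    (lam : Fin n → Coord n → ℝ) (V : Coord n → ℝ) :
    SolvesPotentialEq O (euclid n) (diagProduct lam) V ↔ ContDiffOn ℝ ∞ V O ∧ ∀ x ∈ O,
      (∀ i j, i ≠ j → pd i (pd j V) x = 0) ∧
      ∀ i j, pd i (pd i V) x - 3 * lam i x * pd i V x
        = pd j (pd j V) x - 3 * lam j x * pd j V x := by
  have hn' : (n : ℝ) ≠ 0 := by exact_mod_cast hn
  refine and_congr_right fun _ => forall₂_congr fun x _ => ?_
  have key : ∀ i, ∑ k, structureTensorHat (euclid n) (diagProduct lam) k i i x * pd k V x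
      = 3 * lam i x * pd i V x - 1 / (n : ℝ) * ∑ k, 3 * lam k x * pd k V x := by
    intro i
    simp only [structureTensorHat_diagProduct, if_true, mul_sub, sub_mul, Finset.sum_sub_distrib,
      Finset.mul_sum, mul_ite, ite_mul, mul_zero, zero_mul, Finset.sum_ite_eq, Finset.mem_univ]
    congr 1
    exact Finset.sum_congr rfl fun k _ => by ring
  have off : ∀ i j, i ≠ j →
      ∑ k, structureTensorHat (euclid n) (diagProduct lam) k i j x * pd k V x = 0 := by
    intro i j hij
    simp [structureTensorHat_diagProduct, hij]
  have split : ∑ k, (pd k (pd k V) x - 3 * lam k x * pd k V x)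
      = ∑ k, pd k (pd k V) x - ∑ k, 3 * lam k x * pd k V x := Finset.sum_sub_distrib _ _
  simp only [hessian_euclid, laplacian_euclid]
  constructor
  · intro h
    have hd : ∀ i, pd i (pd i V) x - 3 * lam i x * pd i V x
        = 1 / (n : ℝ) * ∑ k, pd k (pd k V) x - 1 / (n : ℝ) * ∑ k, 3 * lam k x * pd k V x := by
      intro i
      have := h i i
      rw [key] at this
      simp only [euclid, Matrix.one_apply_eq, mul_one] at this
      linarith
    refine ⟨fun i j hij => ?_, fun i j => by rw [hd i, hd j]⟩
    have := h i j
    rw [off i j hij] at this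
    simpa [euclid, hij] using this
  · rintro ⟨h1, h2⟩ i j
    by_cases hij : i = j
    · subst hij
      rw [key]
      have hs : ∑ k, (pd k (pd k V) x - 3 * lam k x * pd k V x)
          = n * (pd i (pd i V) x - 3 * lam i x * pd i V x) := by
        rw [Finset.sum_congr rfl fun k _ => h2 k i]
        simp [mul_sub]
      rw [split] at hs
      simp only [euclid, Matrix.one_apply_eq, mul_one]
      field_simp
      linarith
    · rw [off i j hij, h1 i j hij]
      simp [euclid, hij]

/-! Partial derivatives. -/

theorem pd_add {f h : Coord n → ℝ} {x : Coord n} (i : Fin n) (hf : DifferentiableAt ℝ f x)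
    (hh : DifferentiableAt ℝ h x) : pd i (fun y => f y + h y) x = pd i f x + pd i h x := by
  simp [pd, fderiv_fun_add hf hh]

theorem pd_sub {f h : Coord n → ℝ} {x : Coord n} (i : Fin n) (hf : DifferentiableAt ℝ f x)
    (hh : DifferentiableAt ℝ h x) : pd i (fun y => f y - h y) x = pd i f x - pd i h x := by
  simp [pd, fderiv_fun_sub hf hh]

theorem pd_mul {f h : Coord n → ℝ} {x : Coord n} (i : Fin n) (hf : DifferentiableAt ℝ f x)
    (hh : DifferentiableAt ℝ h x) :
    pd i (fun y => f y * h y) x = pd i f x * h x + f x * pd i h x := by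
  simp [pd, fderiv_fun_mul hf hh]; ring

theorem pd_congr {f h : Coord n → ℝ} {O : Set (Coord n)} (hO : IsOpen O) (hfh : Set.EqOn f h O)
    {x : Coord n} (hx : x ∈ O) (i : Fin n) : pd i f x = pd i h x := by
  simp [pd, (hfh.eventuallyEq_of_mem (hO.mem_nhds hx)).fderiv_eq]

theorem contDiffOn_pd {f : Coord n → ℝ} {O : Set (Coord n)} (hO : IsOpen O)
    (hf : ContDiffOn ℝ ∞ f O) (i : Fin n) : ContDiffOn ℝ ∞ (pd i f) O :=
  (hf.fderiv_of_isOpen hO (m := ∞) (by simp)).clm_apply contDiffOn_const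

theorem pd_comm {f : Coord n → ℝ} {O : Set (Coord n)} (hO : IsOpen O)
    (hf : ContDiffOn ℝ ∞ f O) {x : Coord n} (hx : x ∈ O) (i j : Fin n) :
    pd i (pd j f) x = pd j (pd i f) x := by
  have hfx : ContDiffAt ℝ ∞ f x := hf.contDiffAt (hO.mem_nhds hx)
  have hd : DifferentiableAt ℝ (fderiv ℝ f) x :=
    ((hf.fderiv_of_isOpen hO (m := ∞) (by simp)).contDiffAt (hO.mem_nhds hx)).differentiableAt
      (by simp)
  have key : ∀ v w : Coord n, fderiv ℝ (fun y => fderiv ℝ f y v) x w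
      = fderiv ℝ (fderiv ℝ f) x w v := by
    intro v w
    rw [fderiv_clm_apply hd (differentiableAt_const v)]
    simp
  have hs : IsSymmSndFDerivAt ℝ f x := hfx.isSymmSndFDerivAt (by simpa using WithTop.coe_le_coe.2 (le_top : (2 : ℕ∞) ≤ ⊤))
  change fderiv ℝ (fun y => fderiv ℝ f y (ev j)) x (ev i)
    = fderiv ℝ (fun y => fderiv ℝ f y (ev i)) x (ev j)
  rw [key, key]
  exact hs _ _

theorem eq_sum_smul_ev (v : Coord n) : v = ∑ i, v i • (ev i : Coord n) := by
  ext j; simp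

theorem exists_const_of_pd_eq_zero {f : Coord n → ℝ} {O : Set (Coord n)} (hO : IsOpen O)
    (hc : IsPreconnected O) (hf : DifferentiableOn ℝ f O) (h : ∀ x ∈ O, ∀ i, pd i f x = 0) :
    ∃ c, ∀ x ∈ O, f x = c := by
  refine hO.exists_is_const_of_fderiv_eq_zero hc hf fun x hx => ?_
  ext v
  rw [eq_sum_smul_ev v, map_sum]
  exact Finset.sum_eq_zero fun i _ => by
    rw [map_smul]; have := h x hx i; simp only [pd] at this; simp [this]

theorem hasFDerivAt_comp_coord {u : ℝ → ℝ} {u' : ℝ} (i : Fin n) {x : Coord n}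
    (hu : HasDerivAt u u' (x i)) :
    HasFDerivAt (fun y : Coord n => u (y i)) (u' • ContinuousLinearMap.proj (R := ℝ) i) x :=
  hu.comp_hasFDerivAt x (hasFDerivAt_apply i x)

theorem pd_comp_coord {u : ℝ → ℝ} {u' : ℝ} (i k : Fin n) {x : Coord n}
    (hu : HasDerivAt u u' (x i)) :
    pd k (fun y : Coord n => u (y i)) x = if k = i then u' else 0 := by
  simp [pd, (hasFDerivAt_comp_coord i hu).fderiv, eq_comm]

/-! The Smorodinski-Winternitz potential as a sum of functions of one variable. -/

/-- The part of the Smorodinski-Winternitz potential that depends on the `i`-th coordinate `s`. -/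
noncomputable def swTerm (m : ℕ) (c₀ : ℝ) (c : Fin n → ℝ) (i : Fin n) (s : ℝ) : ℝ :=
  if i.val < m then c₀ * (4 * s ^ 2) + c i * s else c₀ * s ^ 2 + c i / s ^ 2

/-- The derivative of `swTerm`. -/
noncomputable def swSlope (m : ℕ) (c₀ : ℝ) (c : Fin n → ℝ) (i : Fin n) (s : ℝ) : ℝ :=
  if i.val < m then 8 * c₀ * s + c i else 2 * c₀ * s - 2 * c i / s ^ 3

theorem swPotential_eq_sum (m : ℕ) (c₀ : ℝ) (c : Fin n → ℝ) (d : ℝ) (y : Coord n) :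
    swPotential m c₀ c d y = ∑ i, swTerm m c₀ c i (y i) + d := by
  have : ∀ i, swTerm m c₀ c i (y i) = c₀ * (4 * (if i.val < m then y i ^ 2 else 0)
      + if ¬ i.val < m then y i ^ 2 else 0) + (if i.val < m then c i * y i else 0)
      + if ¬ i.val < m then c i / y i ^ 2 else 0 := by
    intro i
    by_cases hi : i.val < m <;> simp [swTerm, hi]
  simp only [this, Finset.sum_add_distrib, ← Finset.mul_sum, swPotential, Finset.sum_filter]

theorem hasDerivAt_swTerm (m : ℕ) (c₀ : ℝ) (c : Fin n → ℝ) (i : Fin n) {s : ℝ}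
    (hs : ¬ i.val < m → s ≠ 0) : HasDerivAt (swTerm m c₀ c i) (swSlope m c₀ c i s) s := by
  by_cases hi : i.val < m
  · have h1 : swTerm m c₀ c i = fun s => c₀ * (4 * s ^ 2) + c i * s := by
      ext s; simp [swTerm, hi]
    rw [h1]
    refine (((hasDerivAt_pow 2 s).const_mul 4).const_mul c₀).fun_add
      ((hasDerivAt_id s).const_mul (c i)) |>.congr_deriv ?_
    simp [swSlope, hi]; ring
  · have hs := hs hi
    have h1 : swTerm m c₀ c i = fun s => c₀ * s ^ 2 + c i / s ^ 2 := by
      ext s; simp [swTerm, hi]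
    rw [h1]
    refine ((hasDerivAt_pow 2 s).const_mul c₀).fun_add
      ((hasDerivAt_const s (c i)).fun_div (hasDerivAt_pow 2 s) (pow_ne_zero 2 hs)) |>.congr_deriv ?_
    simp [swSlope, hi]; field_simp; ring

/-- This is the separated equation `u' = 3λu + 8c₀`. The inhomogeneity is the same for every index
because `4s²` at a regular index and `s²` at a singular one both produce `8`; this is the origin of
the ratio 4 : 1 in the potential. -/
theorem hasDerivAt_swSlope (m : ℕ) (c₀ : ℝ) (c : Fin n → ℝ) (i : Fin n) {s : ℝ}
    (hs : ¬ i.val < m → s ≠ 0) :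
    HasDerivAt (swSlope m c₀ c i)
      (8 * c₀ + if i.val < m then 0 else - (3 / s) * swSlope m c₀ c i s) s := by
  by_cases hi : i.val < m
  · have h1 : swSlope m c₀ c i = fun s => 8 * c₀ * s + c i := by
      ext s; simp [swSlope, hi]
    rw [h1]
    simpa [hi] using ((hasDerivAt_id s).const_mul (8 * c₀)).add_const (c i)
  · have hs := hs hi
    have h1 : swSlope m c₀ c i = fun s => 2 * c₀ * s - 2 * c i / s ^ 3 := by
      ext s; simp [swSlope, hi]
    rw [h1]
    refine ((hasDerivAt_id s).const_mul (2 * c₀)).fun_sub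
      ((hasDerivAt_const s (2 * c i)).fun_div (hasDerivAt_pow 3 s) (pow_ne_zero 3 hs)) |>.congr_deriv ?_
    simp [hi]; field_simp; ring

theorem contDiffAt_swTerm (m : ℕ) (c₀ : ℝ) (c : Fin n → ℝ) (i : Fin n) {s : ℝ}
    (hs : ¬ i.val < m → s ≠ 0) : ContDiffAt ℝ ∞ (swTerm m c₀ c i) s := by
  by_cases hi : i.val < m
  · have h1 : swTerm m c₀ c i = fun s => c₀ * (4 * s ^ 2) + c i * s := by
      ext s; simp [swTerm, hi]
    rw [h1]; fun_prop
  · have hs := hs hi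
    have h1 : swTerm m c₀ c i = fun s => c₀ * s ^ 2 + c i / s ^ 2 := by
      ext s; simp [swTerm, hi]
    rw [h1]
    have : s ^ 2 ≠ 0 := pow_ne_zero 2 hs
    exact (by fun_prop : ContDiffAt ℝ ∞ (fun s : ℝ => c₀ * s ^ 2) s).add
      (contDiffAt_const.div (by fun_prop) this)

theorem contDiffAt_swPotential (m : ℕ) (c₀ : ℝ) (c : Fin n → ℝ) (d : ℝ) {x : Coord n}
    (hx : ∀ j : Fin n, ¬ j.val < m → x j ≠ 0) : ContDiffAt ℝ ∞ (swPotential m c₀ c d) x := by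
  rw [funext (swPotential_eq_sum m c₀ c d)]
  refine ContDiffAt.add (ContDiffAt.sum fun i _ => ?_) contDiffAt_const
  exact (contDiffAt_swTerm m c₀ c i (hx i)).comp x (contDiff_apply ℝ ℝ i).contDiffAt

theorem hasFDerivAt_swPotential (m : ℕ) (c₀ : ℝ) (c : Fin n → ℝ) (d : ℝ) {x : Coord n}
    (hx : ∀ j : Fin n, ¬ j.val < m → x j ≠ 0) :
    HasFDerivAt (swPotential m c₀ c d)
      (∑ i, swSlope m c₀ c i (x i) • ContinuousLinearMap.proj (R := ℝ) (φ := fun _ => ℝ) i) x := by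
  rw [funext (swPotential_eq_sum m c₀ c d)]
  exact (HasFDerivAt.fun_sum fun i _ =>
    hasFDerivAt_comp_coord i (hasDerivAt_swTerm m c₀ c i (hx i))).add_const d

theorem pd_swPotential (m : ℕ) (c₀ : ℝ) (c : Fin n → ℝ) (d : ℝ) {x : Coord n}
    (hx : ∀ j : Fin n, ¬ j.val < m → x j ≠ 0) (i : Fin n) :
    pd i (swPotential m c₀ c d) x = swSlope m c₀ c i (x i) := by
  simp [pd, (hasFDerivAt_swPotential m c₀ c d hx).fderiv]

theorem solvesPotentialEq_swPotential (hn : n ≠ 0) {m : ℕ} {O : Set (Coord n)} (hO : IsOpen O)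
    (hne : ∀ y ∈ O, ∀ j : Fin n, ¬ j.val < m → y j ≠ 0) {c₀ : ℝ} {c : Fin n → ℝ} {d : ℝ}
    {V : Coord n → ℝ} (hV : Set.EqOn V (swPotential m c₀ c d) O) :
    SolvesPotentialEq O (euclid n) (diagProduct (normalLam m)) V := by
  have h1 : ∀ i, ∀ x ∈ O, pd i V x = swSlope m c₀ c i (x i) := fun i x hx => by
    rw [pd_congr hO hV hx, pd_swPotential m c₀ c d (hne x hx)]
  have h2 : ∀ i j, ∀ x ∈ O, pd j (pd i V) x
      = if j = i then 8 * c₀ + (if i.val < m then 0 else - (3 / x i) * swSlope m c₀ c i (x i))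
        else 0 := fun i j x hx => by
    rw [pd_congr hO (h1 i) hx,
      pd_comp_coord i j (hasDerivAt_swSlope m c₀ c i (hne x hx i))]
  rw [solvesPotentialEq_diagProduct_iff hn]
  refine ⟨ContDiffOn.congr (fun x hx =>
    (contDiffAt_swPotential m c₀ c d (hne x hx)).contDiffWithinAt) hV, fun x hx => ⟨?_, ?_⟩⟩
  · intro i j hij
    rw [h2 j i x hx, if_neg hij]
  · have : ∀ i, pd i (pd i V) x - 3 * normalLam m i x * pd i V x = 8 * c₀ := by
      intro i
      rw [h2 i i x hx, if_pos rfl, h1 i x hx]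
      unfold normalLam
      split_ifs with hi
      · ring
      · ring
    intro i j
    rw [this i, this j]

/-- The equations are integrated through first integrals, functions on `O` with zero gradient.
Connectedness of `O` then suffices, and no product structure of the domain is needed. -/
theorem exists_swPotential_of_solvesPotentialEq (hn : 2 ≤ n) {m : ℕ} {O : Set (Coord n)}
    (hO : IsOpen O) (hc : IsPreconnected O)
    (hne : ∀ y ∈ O, ∀ j : Fin n, ¬ j.val < m → y j ≠ 0) {V : Coord n → ℝ}
    (hV : SolvesPotentialEq O (euclid n) (diagProduct (normalLam m)) V) :
    ∃ (c₀ : ℝ) (c : Fin n → ℝ) (d : ℝ), Set.EqOn V (swPotential m c₀ c d) O := by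
  rw [solvesPotentialEq_diagProduct_iff (by omega)] at hV
  obtain ⟨hsm, hV⟩ := hV
  have hdiff : ∀ {f : Coord n → ℝ}, ContDiffOn ℝ ∞ f O → ∀ x ∈ O, DifferentiableAt ℝ f x :=
    fun hf x hx => (hf.contDiffAt (hO.mem_nhds hx)).differentiableAt (by simp)
  have s1 : ∀ i, ContDiffOn ℝ ∞ (pd i V) O := contDiffOn_pd hO hsm
  have s2 : ∀ i j, ContDiffOn ℝ ∞ (pd i (pd j V)) O := fun i j => contDiffOn_pd hO (s1 j) i
  have hlam : ∀ i, ∀ x ∈ O, DifferentiableAt ℝ (normalLam m i) x ∧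
      ∀ j, j ≠ i → pd j (normalLam m i) x = 0 := by
    intro i x hx
    by_cases hi : i.val < m
    · have : normalLam (n := n) m i = fun _ => 0 := by ext; simp [normalLam, hi]
      rw [this]; simp [pd]
    · have : normalLam (n := n) m i = fun y => (fun s : ℝ => -(1 / s)) (y i) := by
        ext; simp [normalLam, hi]
      have hd : HasDerivAt (fun s : ℝ => -(1 / s)) (-(-(x i ^ 2)⁻¹)) (x i) := by
        simpa using (hasDerivAt_inv (hne x hx i hi)).fun_neg
      rw [this]
      exact ⟨(hasFDerivAt_comp_coord i hd).differentiableAt, fun j hj => by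
        rw [pd_comp_coord i j hd, if_neg hj]⟩
  let i₀ : Fin n := ⟨0, by omega⟩
  have hρ : ∃ ρ, ∀ x ∈ O, pd i₀ (pd i₀ V) x - 3 * normalLam m i₀ x * pd i₀ V x = ρ := by
    refine exists_const_of_pd_eq_zero hO hc ?_ ?_
    · intro x hx
      have a1 := hdiff (s2 i₀ i₀) x hx
      have a2 := hdiff (s1 i₀) x hx
      have a3 := (hlam i₀ x hx).1
      exact (a1.sub ((a3.const_mul 3).mul a2)).differentiableWithinAt
    · intro x hx j
      -- To differentiate in direction `j`, the common value is rewritten with an index `i ≠ j`;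
      -- every term then depends on `xᵢ` alone. This needs a second index.
      obtain ⟨i, hi⟩ : ∃ i : Fin n, i ≠ j :=
        haveI : Nontrivial (Fin n) := Fin.nontrivial_iff_two_le.2 hn
        exists_ne j
      rw [pd_congr hO (fun y hy => (hV y hy).2 i₀ i) hx]
      have a1 := hdiff (s2 i i) x hx
      have a2 := hdiff (s1 i) x hx
      have a3 := (hlam i x hx).1
      have b1 : pd j (pd i (pd i V)) x = 0 := by
        rw [pd_comm hO (s1 i) hx,
          pd_congr (h := fun _ => 0) hO (fun y hy => (hV y hy).1 j i hi.symm) hx]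
        simp [pd]
      have b2 : pd j (pd i V) x = 0 := (hV x hx).1 j i hi.symm
      rw [pd_sub j a1 ((a3.const_mul 3).fun_mul a2), pd_mul j (a3.const_mul 3) a2,
        pd_mul j (differentiableAt_const _) a3, (hlam i x hx).2 j hi.symm, b1, b2]
      simp [pd]
  obtain ⟨ρ, hρ⟩ := hρ
  have hρ' : ∀ i, ∀ x ∈ O, pd i (pd i V) x = 3 * normalLam m i x * pd i V x + ρ := by
    intro i x hx
    have := (hV x hx).2 i i₀
    rw [hρ x hx] at this
    linarith
  -- The common value for the family is `8c₀`, so `c₀ = ρ / 8`.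
  have hci : ∀ i : Fin n, ∃ ci : ℝ, ∀ x ∈ O, pd i V x = swSlope m (ρ / 8) (fun _ => ci) i (x i) := by
    intro i
    by_cases hi : i.val < m
    · have hu : ∀ s : ℝ, HasDerivAt (fun s : ℝ => ρ * s) ρ s := fun s => by
        simpa using (hasDerivAt_id s).const_mul ρ
      obtain ⟨ci, h⟩ : ∃ ci, ∀ x ∈ O, pd i V x - ρ * x i = ci := by
        refine exists_const_of_pd_eq_zero hO hc ?_ ?_
        · intro x hx
          exact ((hdiff (s1 i) x hx).sub
            (hasFDerivAt_comp_coord i (hu (x i))).differentiableAt).differentiableWithinAt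
        · intro x hx j
          rw [pd_sub j (hdiff (s1 i) x hx) (hasFDerivAt_comp_coord i (hu (x i))).differentiableAt,
            pd_comp_coord i j (hu (x i))]
          by_cases hj : j = i
          · subst hj
            rw [hρ' j x hx]; simp [normalLam, hi]
          · rw [(hV x hx).1 j i hj]; simp [hj]
      refine ⟨ci, fun x hx => ?_⟩
      simp only [swSlope, hi, if_true]
      linarith [h x hx]
    · have hu : ∀ s : ℝ, HasDerivAt (fun s : ℝ => s ^ 3) (3 * s ^ 2) s := fun s => by
        simpa using hasDerivAt_pow 3 s
      have hw : ∀ s : ℝ, HasDerivAt (fun s : ℝ => ρ / 4 * s ^ 4) (ρ * s ^ 3) s := fun s => by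
        refine (hasDerivAt_pow 4 s).const_mul (ρ / 4) |>.congr_deriv ?_
        simp; ring
      -- The integrating factor of `u' = -(3/x)u + ρ` is `x³`, as `(x³u)' = ρx³`.
      obtain ⟨ci, h⟩ : ∃ ci, ∀ x ∈ O, x i ^ 3 * pd i V x - ρ / 4 * x i ^ 4 = ci := by
        have d1 := fun x hx => hdiff (s1 i) x hx
        have d2 := fun x => (hasFDerivAt_comp_coord (x := x) i (hu (x i))).differentiableAt
        have d3 := fun x => (hasFDerivAt_comp_coord (x := x) i (hw (x i))).differentiableAt
        refine exists_const_of_pd_eq_zero hO hc ?_ ?_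
        · intro x hx
          exact (((d2 x).mul (d1 x hx)).sub (d3 x)).differentiableWithinAt
        · intro x hx j
          rw [pd_sub j ((d2 x).fun_mul (d1 x hx)) (d3 x), pd_mul j (d2 x) (d1 x hx),
            pd_comp_coord i j (hu (x i)), pd_comp_coord i j (hw (x i))]
          by_cases hj : j = i
          · subst hj
            have := hne x hx j hi
            rw [hρ' j x hx]; simp [normalLam, hi]
            field_simp
            ring
          · rw [(hV x hx).1 j i hj]; simp [hj]
      refine ⟨-ci / 2, fun x hx => ?_⟩
      have := hne x hx i hi
      simp only [swSlope, hi, if_false]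
      have := h x hx
      field_simp
      linarith
  choose c hc' using hci
  obtain ⟨d, hd⟩ : ∃ d, ∀ x ∈ O, V x - swPotential m (ρ / 8) c 0 x = d := by
    refine exists_const_of_pd_eq_zero hO hc ?_ ?_
    · intro x hx
      exact ((hdiff hsm x hx).sub (hasFDerivAt_swPotential m _ c 0
        (hne x hx)).differentiableAt).differentiableWithinAt
    · intro x hx j
      rw [pd_sub j (hdiff hsm x hx) (hasFDerivAt_swPotential m _ c 0 (hne x hx)).differentiableAt,
        hc' j x hx, pd_swPotential _ _ _ _ (hne x hx)]
      simp [swSlope]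
  refine ⟨ρ / 8, c, d, fun x hx => ?_⟩
  have := hd x hx
  rw [swPotential_eq_sum] at this ⊢
  linarith

/-- The general solution of the potential equation for the normal form. -/
theorem solvesPotentialEq_normalLam_iff (hn : 2 ≤ n) {m : ℕ} {O : Set (Coord n)}
    (hO : IsOpen O) (hc : IsPreconnected O)
    (hne : ∀ y ∈ O, ∀ j : Fin n, ¬ j.val < m → y j ≠ 0) (V : Coord n → ℝ) :
    SolvesPotentialEq O (euclid n) (diagProduct (normalLam m)) V ↔
      ∃ (c₀ : ℝ) (c : Fin n → ℝ) (d : ℝ), Set.EqOn V (swPotential m c₀ c d) O :=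
  ⟨exists_swPotential_of_solvesPotentialEq hn hO hc hne,
    fun ⟨_, _, _, h⟩ => solvesPotentialEq_swPotential (by omega) hO hne h⟩

/-! Killing tensors as symmetric products of Killing fields. -/

/-- A smooth Killing field of Euclidean space, in terms of its components. -/
structure IsKillingField (ξ : Coord n → Coord n) : Prop where
  smooth : ∀ a, ContDiff ℝ ∞ (fun y => ξ y a)
  killing : ∀ x a l, pd l (fun y => ξ y a) x + pd a (fun y => ξ y l) x = 0

/-- The symmetric product of two covector fields. -/
noncomputable def symProd (ξ η : Coord n → Coord n) : TwoTensor n := fun x =>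
  Matrix.of fun a b => (ξ x a * η x b + ξ x b * η x a) / 2

/-- The rotation field with `ξ · p = xᵢ pⱼ - xⱼ pᵢ`. -/
def rot (i j : Fin n) (x : Coord n) : Coord n := fun a =>
  x i * (ev j : Coord n) a - x j * (ev i : Coord n) a

theorem isKillingField_ev (i : Fin n) : IsKillingField (fun _ : Coord n => (ev i : Coord n)) where
  smooth a := contDiff_const
  killing x a l := by simp [pd]

theorem IsKillingField.differentiableAt {ξ : Coord n → Coord n} (hξ : IsKillingField ξ) (a : Fin n)
    (x : Coord n) : DifferentiableAt ℝ (fun y => ξ y a) x :=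
  (hξ.smooth a).contDiffAt.differentiableAt (by simp)

theorem pd_rot (i j a l : Fin n) (x : Coord n) :
    pd l (fun y => rot i j y a) x
      = (ev l : Coord n) i * (ev j : Coord n) a - (ev l : Coord n) j * (ev i : Coord n) a := by
  have h : HasFDerivAt (fun y : Coord n => rot i j y a) _ x :=
    ((hasFDerivAt_apply (𝕜 := ℝ) i x).mul_const ((ev j : Coord n) a)).fun_sub
      ((hasFDerivAt_apply (𝕜 := ℝ) j x).mul_const ((ev i : Coord n) a))
  simp only [pd, h.fderiv, sub_apply, smul_apply, ContinuousLinearMap.proj_apply, smul_eq_mul]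
  ring

theorem isKillingField_rot (i j : Fin n) : IsKillingField (rot i j) where
  smooth a := by
    unfold rot
    exact ((contDiff_apply ℝ ℝ i).mul contDiff_const).sub
      ((contDiff_apply ℝ ℝ j).mul contDiff_const)
  killing x a l := by
    rw [pd_rot, pd_rot]
    simp only [ev_apply, eq_comm (a := i), eq_comm (a := j)]
    ring

theorem pd_symProd {ξ η : Coord n → Coord n} (hξ : IsKillingField ξ) (hη : IsKillingField η)
    (l a b : Fin n) (x : Coord n) :
    pd l (fun y => symProd ξ η y a b) x =
      (pd l (fun y => ξ y a) x * η x b + ξ x a * pd l (fun y => η y b) x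
        + (pd l (fun y => ξ y b) x * η x a + ξ x b * pd l (fun y => η y a) x)) / 2 := by
  have d1 := fun c => hξ.differentiableAt c x
  have d2 := fun c => hη.differentiableAt c x
  have h : (fun y => symProd ξ η y a b) = fun y => (ξ y a * η y b + ξ y b * η y a) * (1 / 2) := by
    ext y; simp [symProd]; ring
  rw [h, pd_mul l (((d1 a).fun_mul (d2 b)).fun_add ((d1 b).fun_mul (d2 a)))
    (differentiableAt_const _), pd_add l ((d1 a).fun_mul (d2 b)) ((d1 b).fun_mul (d2 a)),
    pd_mul l (d1 a) (d2 b), pd_mul l (d1 b) (d2 a)]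
  simp [pd]; ring

theorem covDeriv_euclid (K : TwoTensor n) (l i j : Fin n) (x : Coord n) :
    covDeriv (euclid n) K l i j x = pd l (fun y => K y i j) x := by
  simp [covDeriv]

theorem isSymTensor_symProd {ξ η : Coord n → Coord n} (hξ : IsKillingField ξ)
    (hη : IsKillingField η) (O : Set (Coord n)) : IsSymTensor O (symProd ξ η) where
  smooth i j := by
    unfold symProd
    exact ((((hξ.smooth i).mul (hη.smooth j)).add
      ((hξ.smooth j).mul (hη.smooth i))).div_const 2).contDiffOn
  symm x _ := by
    ext a b; simp [symProd]; ring

/-- The cyclic sum of derivatives is a combination of the symmetrised derivatives of `ξ` and `η`,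
each of which vanishes. -/
theorem isKilling_symProd {ξ η : Coord n → Coord n} (hξ : IsKillingField ξ)
    (hη : IsKillingField η) (O : Set (Coord n)) : IsKilling O (euclid n) (symProd ξ η) where
  toIsSymTensor := isSymTensor_symProd hξ hη O
  killing x _ i j l := by
    simp only [covDeriv_euclid, pd_symProd hξ hη]
    linear_combination (η x i * hξ.killing x j l + ξ x i * hη.killing x j l
      + η x j * hξ.killing x i l + ξ x j * hη.killing x i l
      + η x l * hξ.killing x i j + ξ x l * hη.killing x i j) / 2

/-- For a diagonal product the Bertrand-Darboux condition follows from a condition on the Killing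
tensor alone. -/
theorem bertrandDarboux_of_coeff_eq_zero {O : Set (Coord n)} {lam : Fin n → Coord n → ℝ}
    {K : TwoTensor n} (hK : IsSymTensor O K)
    (h : ∀ x ∈ O, ∀ i j a, i ≠ j → pd j (fun y => K y a i) x - pd i (fun y => K y a j) x
      + 3 * lam a x * K x i j * ((ev j : Coord n) a - (ev i : Coord n) a) = 0)
    (V : Coord n → ℝ) : BertrandDarboux O (euclid n) (diagProduct lam) K V := by
  intro x hx i j
  refine Finset.sum_eq_zero fun a _ => ?_
  have hm : ∀ b i, mixed (euclid n) K b i x = K x b i := by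
    intro b i; simp [mixed, euclid_apply, Matrix.one_apply]
  have hc : ∀ a i j, covDerivMixed (euclid n) K a i j x = pd j (fun y => K y a i) x := by
    intro a i j; simp [covDerivMixed, euclid_apply, Matrix.one_apply, covDeriv_euclid]
  have hs : ∀ i j, ∑ b, K x b i * structureTensorHat (euclid n) (diagProduct lam) a b j x
      = K x j i * (3 * ((if j = a then lam a x else 0) - 1 / (n : ℝ) * lam a x)) := by
    intro i j
    simp only [structureTensorHat_diagProduct, mul_ite, mul_zero, Finset.sum_ite_eq',
      Finset.mem_univ, if_true]
  rw [Finset.sum_sub_distrib]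
  simp only [hm, hc, hs]
  by_cases hij : i = j
  · subst hij; simp
  · have e := h x hx i j a hij
    have e2 : K x j i = K x i j := (hK.symm x hx).apply i j
    -- Once `K` is symmetric, the trace part of the structure tensor cancels under
    -- skew-symmetrisation.
    rw [e2]
    refine mul_eq_zero_of_left ?_ _
    refine Eq.trans ?_ e
    simp only [ev_apply, eq_comm (a := i), eq_comm (a := j)]
    split_ifs <;> ring

/-! Differentials of quadratic functions on phase space. -/

theorem hamiltonian_euclid (V : Coord n → ℝ) (z : Coord n × Coord n) :
    hamiltonian (euclid n) V z = z.2 ⬝ᵥ z.2 + V z.1 := by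
  simp [hamiltonian, euclid_apply]

theorem quadratic_symProd (ξ η : Coord n → Coord n) (W : Coord n → ℝ) (z : Coord n × Coord n) :
    quadratic (euclid n) (symProd ξ η) W z = (ξ z.1 ⬝ᵥ z.2) * (η z.1 ⬝ᵥ z.2) + W z.1 := by
  have h : symProd ξ η z.1 *ᵥ z.2
      = ((η z.1 ⬝ᵥ z.2) / 2) • ξ z.1 + ((ξ z.1 ⬝ᵥ z.2) / 2) • η z.1 := by
    ext a
    simp only [Matrix.mulVec, dotProduct, symProd, Matrix.of_apply, Pi.add_apply, Pi.smul_apply,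
      smul_eq_mul, Finset.sum_div, Finset.sum_mul, ← Finset.sum_add_distrib]
    exact Finset.sum_congr rfl fun b _ => by ring
  simp only [quadratic, euclid_apply, inv_one, one_mul, mul_one]
  rw [h, dotProduct_add, dotProduct_smul, dotProduct_smul, dotProduct_comm z.2 (ξ z.1),
    dotProduct_comm z.2 (η z.1)]
  simp only [smul_eq_mul]
  ring

theorem hasFDerivAt_fst_comp {W : Coord n → ℝ} {z : Coord n × Coord n}
    (hW : DifferentiableAt ℝ W z.1) :
    HasFDerivAt (fun z : Coord n × Coord n => W z.1)
      ((fderiv ℝ W z.1).comp (ContinuousLinearMap.fst ℝ (Coord n) (Coord n))) z :=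
  hW.hasFDerivAt.comp z hasFDerivAt_fst

theorem hasFDerivAt_momentum (a : Fin n) (z : Coord n × Coord n) :
    HasFDerivAt (fun z : Coord n × Coord n => z.2 a)
      ((ContinuousLinearMap.proj (R := ℝ) (φ := fun _ : Fin n => ℝ) a).comp
        (ContinuousLinearMap.snd ℝ (Coord n) (Coord n))) z :=
  (hasFDerivAt_apply (𝕜 := ℝ) a z.2).comp z hasFDerivAt_snd

theorem hasFDerivAt_linear {ξ : Coord n → Coord n} (hξ : IsKillingField ξ)
    (z : Coord n × Coord n) :
    ∃ D : Coord n × Coord n →L[ℝ] ℝ, HasFDerivAt (fun z => ξ z.1 ⬝ᵥ z.2) D z ∧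
      ∀ k, D (ev k, 0) = ∑ a, pd k (fun y => ξ y a) z.1 * z.2 a ∧ D (0, ev k) = ξ z.1 k := by
  refine ⟨_, HasFDerivAt.fun_sum fun a _ =>
    (hasFDerivAt_fst_comp (hξ.differentiableAt a z.1)).mul (hasFDerivAt_momentum a z),
    fun k => ⟨?_, ?_⟩⟩
  · simp [pd, mul_comm]
  · simp

theorem fderiv_quadratic {ξ η : Coord n → Coord n} (hξ : IsKillingField ξ)
    (hη : IsKillingField η) {W : Coord n → ℝ} {z : Coord n × Coord n}
    (hW : DifferentiableAt ℝ W z.1) (k : Fin n) :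
    fderiv ℝ (quadratic (euclid n) (symProd ξ η) W) z (ev k, 0) =
        (∑ a, pd k (fun y => ξ y a) z.1 * z.2 a) * (η z.1 ⬝ᵥ z.2)
          + (ξ z.1 ⬝ᵥ z.2) * (∑ a, pd k (fun y => η y a) z.1 * z.2 a) + pd k W z.1 ∧
      fderiv ℝ (quadratic (euclid n) (symProd ξ η) W) z (0, ev k) =
        ξ z.1 k * (η z.1 ⬝ᵥ z.2) + η z.1 k * (ξ z.1 ⬝ᵥ z.2) := by
  obtain ⟨D, hD, hD'⟩ := hasFDerivAt_linear hξ z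
  obtain ⟨E, hE, hE'⟩ := hasFDerivAt_linear hη z
  rw [funext (quadratic_symProd ξ η W),
    ((hD.fun_mul hE).fun_add (hasFDerivAt_fst_comp hW)).fderiv]
  simp only [add_apply, smul_apply, smul_eq_mul,
    ContinuousLinearMap.comp_apply, ContinuousLinearMap.coe_fst', (hD' k).1, (hD' k).2,
    (hE' k).1, (hE' k).2, map_zero]
  constructor
  · simp only [pd]; ring
  · ring

theorem fderiv_hamiltonian {V : Coord n → ℝ} {z : Coord n × Coord n}
    (hV : DifferentiableAt ℝ V z.1) (k : Fin n) :
    fderiv ℝ (hamiltonian (euclid n) V) z (ev k, 0) = pd k V z.1 ∧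
      fderiv ℝ (hamiltonian (euclid n) V) z (0, ev k) = 2 * z.2 k := by
  have h : HasFDerivAt (fun z : Coord n × Coord n => z.2 ⬝ᵥ z.2 + V z.1) _ z :=
    (HasFDerivAt.fun_sum fun a _ => (hasFDerivAt_momentum a z).fun_mul
      (hasFDerivAt_momentum a z)).fun_add (hasFDerivAt_fst_comp hV)
  rw [funext (hamiltonian_euclid V), h.fderiv]
  constructor
  · simp [pd]
  · simp [Finset.sum_add_distrib]; ring

/-- The Jacobian matrix of a Killing field is skew, so its quadratic form vanishes: `ξ · p` is
conserved by the free motion. -/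
theorem sum_sum_pd_eq_zero {ξ : Coord n → Coord n} (hξ : IsKillingField ξ) (x p : Coord n) :
    ∑ k, (∑ a, pd k (fun y => ξ y a) x * p a) * p k = 0 := by
  have h : ∑ k, (∑ a, pd k (fun y => ξ y a) x * p a) * p k
      = -∑ k, (∑ a, pd k (fun y => ξ y a) x * p a) * p k := by
    conv_lhs => simp only [Finset.sum_mul]
    rw [Finset.sum_comm]
    simp only [Finset.sum_mul, ← Finset.sum_neg_distrib]
    refine Finset.sum_congr rfl fun k _ => Finset.sum_congr rfl fun a _ => ?_
    linear_combination p k * p a * hξ.killing x k a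
  linarith

/-- The part of the bracket cubic in `p` vanishes because `ξ · p` and `η · p` are conserved by the
free motion. The part linear in `p` vanishes when `dW = K dV`. -/
theorem poisson_quadratic_eq_zero {ξ η : Coord n → Coord n} (hξ : IsKillingField ξ)
    (hη : IsKillingField η) {V W : Coord n → ℝ} {z : Coord n × Coord n}
    (hV : DifferentiableAt ℝ V z.1) (hW : DifferentiableAt ℝ W z.1)
    (h : ∀ k, pd k W z.1 = ∑ l, symProd ξ η z.1 k l * pd l V z.1) :
    poisson (quadratic (euclid n) (symProd ξ η) W) (hamiltonian (euclid n) V) z = 0 := by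
  have e1 := sum_sum_pd_eq_zero hξ z.1 z.2
  have e2 := sum_sum_pd_eq_zero hη z.1 z.2
  have e3 : ∑ k, pd k W z.1 * (2 * z.2 k) =
      ∑ k, pd k V z.1 * (ξ z.1 k * (η z.1 ⬝ᵥ z.2) + η z.1 k * (ξ z.1 ⬝ᵥ z.2)) := by
    simp only [h, Finset.sum_mul]
    rw [Finset.sum_comm]
    refine Finset.sum_congr rfl fun l _ => ?_
    simp only [dotProduct, Finset.mul_sum, ← Finset.sum_add_distrib]
    refine Finset.sum_congr rfl fun k _ => ?_
    simp only [symProd, Matrix.of_apply]; ring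
  have e4 : ∀ k, fderiv ℝ (quadratic (euclid n) (symProd ξ η) W) z (ev k, 0)
        * fderiv ℝ (hamiltonian (euclid n) V) z (0, ev k)
      - fderiv ℝ (hamiltonian (euclid n) V) z (ev k, 0)
        * fderiv ℝ (quadratic (euclid n) (symProd ξ η) W) z (0, ev k)
      = ((∑ a, pd k (fun y => ξ y a) z.1 * z.2 a) * z.2 k) * (2 * (η z.1 ⬝ᵥ z.2))
        + ((∑ a, pd k (fun y => η y a) z.1 * z.2 a) * z.2 k) * (2 * (ξ z.1 ⬝ᵥ z.2))
        + pd k W z.1 * (2 * z.2 k)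
        - pd k V z.1 * (ξ z.1 k * (η z.1 ⬝ᵥ z.2) + η z.1 k * (ξ z.1 ⬝ᵥ z.2)) := by
    intro k
    rw [(fderiv_quadratic hξ hη hW k).1, (fderiv_quadratic hξ hη hW k).2,
      (fderiv_hamiltonian hV k).1, (fderiv_hamiltonian hV k).2]
    ring
  unfold poisson
  rw [Finset.sum_congr rfl fun k _ => e4 k, Finset.sum_sub_distrib, Finset.sum_add_distrib,
    Finset.sum_add_distrib, ← Finset.sum_mul, ← Finset.sum_mul, e1, e2, e3]
  ring

/-! Functional independence. -/

/-- The vectors `a k`, `b k` stand for `∂/∂xₖ`, `∂/∂pₖ`. For `k ≠ j` only `H`, `h k` and `F k` are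
seen by this pair, and `H` coincides with `h k` on it. A linear relation therefore splits into 2 × 2
systems, and the pair at `j` is left to detect the coefficient of `H`. -/
theorem linearIndependent_option_sum {E : Type*} [NormedAddCommGroup E] [NormedSpace ℝ E]
    (j : Fin n) (H : E →L[ℝ] ℝ) (h F : {i // i ≠ j} → E →L[ℝ] ℝ) (a b : Fin n → E)
    (ha : ∀ i k, k ≠ i.val → h i (a k) = 0) (hb : ∀ i k, k ≠ i.val → h i (b k) = 0)
    (Fa : ∀ i k, k ≠ i.val → k ≠ j → F i (a k) = 0) (Fb : ∀ i k, k ≠ i.val → k ≠ j → F i (b k) = 0)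
    (Ha : ∀ i : {i // i ≠ j}, H (a i) = h i (a i)) (Hb : ∀ i : {i // i ≠ j}, H (b i) = h i (b i))
    (det : ∀ i, h i (a i) * F i (b i) - h i (b i) * F i (a i) ≠ 0)
    (Hj : H (a j) ≠ 0 ∨ H (b j) ≠ 0) :
    LinearIndependent ℝ (fun o : Option ({i // i ≠ j} ⊕ {i // i ≠ j}) =>
      o.elim H (Sum.elim h F)) := by
  rw [Fintype.linearIndependent_iff]
  intro g hg
  have ev : ∀ v : E, g none * H v + ((∑ i, g (some (Sum.inl i)) * h i v)
      + ∑ i, g (some (Sum.inr i)) * F i v) = 0 := by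
    intro v
    have := congrArg (fun L : E →L[ℝ] ℝ => L v) hg
    simpa [Fintype.sum_option, Fintype.sum_sum_type] using this
  have red : ∀ (k : {i // i ≠ j}) (v : E), (∀ i : {i // i ≠ j}, i ≠ k → h i v = 0) →
      (∀ i : {i // i ≠ j}, i ≠ k → F i v = 0) → H v = h k v →
      (g none + g (some (Sum.inl k))) * h k v + g (some (Sum.inr k)) * F k v = 0 := by
    intro k v h1 h2 h3
    have := ev v
    rw [Finset.sum_eq_single k (fun i _ hi => by rw [h1 i hi, mul_zero]) (by simp),
      Finset.sum_eq_single k (fun i _ hi => by rw [h2 i hi, mul_zero]) (by simp), h3] at this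
    linarith
  have ne : ∀ {i k : {i // i ≠ j}}, i ≠ k → (k : Fin n) ≠ i :=
    fun hik e => hik (Subtype.ext e.symm)
  have both : ∀ k, g none + g (some (Sum.inl k)) = 0 ∧ g (some (Sum.inr k)) = 0 := by
    intro k
    have r1 := red k (a k) (fun i hi => ha i k (ne hi)) (fun i hi => Fa i k (ne hi) k.2) (Ha k)
    have r2 := red k (b k) (fun i hi => hb i k (ne hi)) (fun i hi => Fb i k (ne hi) k.2) (Hb k)
    constructor
    · refine (mul_eq_zero.1 ?_).resolve_right (det k)
      linear_combination F k (b k) * r1 - F k (a k) * r2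
    · refine (mul_eq_zero.1 ?_).resolve_right (det k)
      linear_combination h k (a k) * r2 - h k (b k) * r1
  -- On the pair at `j` every `h i` vanishes and the coefficients of the `F i` are already zero, so
  -- only `H` remains.
  have h0 : g none = 0 := by
    rcases Hj with hj | hj
    · have := ev (a j)
      rw [Finset.sum_eq_zero fun i _ => by rw [ha i j i.2.symm, mul_zero],
        Finset.sum_eq_zero fun i _ => by rw [(both i).2, zero_mul]] at this
      simpa [hj] using this
    · have := ev (b j)
      rw [Finset.sum_eq_zero fun i _ => by rw [hb i j i.2.symm, mul_zero],
        Finset.sum_eq_zero fun i _ => by rw [(both i).2, zero_mul]] at this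
      simpa [hj] using this
  rintro (_ | i | i)
  · exact h0
  · have := (both i).1; rwa [h0, zero_add] at this
  · exact (both i).2

/-! Integrals of the Smorodinski-Winternitz system that involve two coordinates. -/

/-- `(ξ · p) (η · p) + W` is an integral of the Smorodinski-Winternitz system, and involves only the
coordinates `i` and `j` and their momenta. -/
structure IsLink (O : Set (Coord n)) (m : ℕ) (c₀ : ℝ) (c : Fin n → ℝ) (i j : Fin n)
    (ξ η : Coord n → Coord n) (W : Coord n → ℝ) : Prop where
  left : IsKillingField ξ
  right : IsKillingField η
  smooth : ∀ x ∈ O, ContDiffAt ℝ ∞ W x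
  gradient : ∀ x ∈ O, ∀ k, pd k W x = ∑ l, symProd ξ η x k l * swSlope m c₀ c l (x l)
  supp : ∀ x k, k ≠ i → k ≠ j → ξ x k = 0 ∧ η x k = 0

/-- The Jacobian of `pᵢ² + Vᵢ(xᵢ)` and `(ξ · p) (η · p) + W` with respect to `xᵢ` and `pᵢ`. -/
noncomputable def linkDet (m : ℕ) (c₀ : ℝ) (c : Fin n → ℝ) (i : Fin n) (ξ η : Coord n → Coord n)
    (z : Coord n × Coord n) : ℝ :=
  swSlope m c₀ c i (z.1 i) * (ξ z.1 i * (η z.1 ⬝ᵥ z.2) + η z.1 i * (ξ z.1 ⬝ᵥ z.2))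
    - 2 * z.2 i * ((∑ a, pd i (fun y => ξ y a) z.1 * z.2 a) * (η z.1 ⬝ᵥ z.2)
        + (ξ z.1 ⬝ᵥ z.2) * (∑ a, pd i (fun y => η y a) z.1 * z.2 a)
        + ∑ l, symProd ξ η z.1 i l * swSlope m c₀ c l (z.1 l))

/-- The condition on `ξ η` under which the Killing tensor `ξ ⊙ η` is compatible. -/
def IsCompatiblePair (O : Set (Coord n)) (m : ℕ) (ξ η : Coord n → Coord n) : Prop :=
  ∀ x ∈ O, ∀ i j a, i ≠ j →
    pd j (fun y => symProd ξ η y a i) x - pd i (fun y => symProd ξ η y a j) x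
      + 3 * normalLam m a x * symProd ξ η x i j * ((ev j : Coord n) a - (ev i : Coord n) a) = 0

theorem isCompatibleKilling_symProd {O : Set (Coord n)} {m : ℕ} {ξ η : Coord n → Coord n}
    (hξ : IsKillingField ξ) (hη : IsKillingField η) (h : IsCompatiblePair O m ξ η) :
    IsCompatibleKilling O (euclid n) (diagProduct (normalLam m)) (symProd ξ η) :=
  ⟨isKilling_symProd hξ hη O,
    fun V _ => bertrandDarboux_of_coeff_eq_zero (isSymTensor_symProd hξ hη O) h V⟩

@[simp]
theorem ev_dotProduct (i : Fin n) (p : Coord n) : (ev i : Coord n) ⬝ᵥ p = p i := by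
  simp [dotProduct]

theorem rot_dotProduct (i j : Fin n) (x p : Coord n) : rot i j x ⬝ᵥ p = x i * p j - x j * p i := by
  have : rot i j x = x i • (ev j : Coord n) - x j • (ev i : Coord n) := by
    ext a; simp [rot]
  simp [this, sub_dotProduct, smul_dotProduct]

theorem sum_pd_ev (i k : Fin n) (x p : Coord n) :
    ∑ a, pd k (fun _ : Coord n => (ev i : Coord n) a) x * p a = 0 := by
  simp [pd]

theorem sum_pd_rot (i j k : Fin n) (x p : Coord n) :
    ∑ a, pd k (fun y => rot i j y a) x * p a
      = (ev k : Coord n) i * p j - (ev k : Coord n) j * p i := by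
  simp [pd_rot, sub_mul, Finset.sum_sub_distrib]

theorem sum_symProd_mul (ξ η : Coord n → Coord n) (x v : Coord n) (k : Fin n) :
    ∑ l, symProd ξ η x k l * v l = (ξ x k * (η x ⬝ᵥ v) + η x k * (ξ x ⬝ᵥ v)) / 2 := by
  simp only [symProd, Matrix.of_apply, dotProduct, Finset.mul_sum, ← Finset.sum_add_distrib,
    Finset.sum_div]
  exact Finset.sum_congr rfl fun l _ => by ring

/-! ### Compatibility of the individual Killing tensors. -/

theorem isCompatiblePair_self (O : Set (Coord n)) (m : ℕ) (k : Fin n) :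
    IsCompatiblePair O m (fun _ : Coord n => (ev k : Coord n)) (fun _ => ev k) := by
  intro x _ i j a hij
  rw [pd_symProd (isKillingField_ev k) (isKillingField_ev k),
    pd_symProd (isKillingField_ev k) (isKillingField_ev k)]
  by_cases hi : i = k
  · subst hi; simp [pd, symProd, hij.symm]
  · simp [pd, symProd, hi]

/-- The tensor `pᵢ pⱼ`. -/
theorem isCompatiblePair_ev_ev (O : Set (Coord n)) (m : ℕ) {i j : Fin n} (hi : i.val < m)
    (hj : j.val < m) :
    IsCompatiblePair O m (fun _ : Coord n => (ev i : Coord n)) (fun _ => ev j) := by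
  intro x _ k l a hkl
  rw [pd_symProd (isKillingField_ev i) (isKillingField_ev j),
    pd_symProd (isKillingField_ev i) (isKillingField_ev j)]
  -- The tensor is constant, so only the algebraic term survives. It can be nonzero only for `a = i`
  -- or `a = j`, and there `λ` vanishes.
  have : normalLam m a x * symProd (fun _ : Coord n => (ev i : Coord n)) (fun _ => ev j) x k l *
      ((ev l : Coord n) a - (ev k : Coord n) a) = 0 := by
    by_cases ha : a = i ∨ a = j
    · have : normalLam m a x = 0 := by
        rcases ha with rfl | rfl <;> simp [normalLam, hi, hj]
      simp [this]
    · push Not at ha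
      by_cases h1 : a = l
      · subst h1; simp [symProd, ha.1, ha.2]
      · by_cases h2 : a = k
        · subst h2; simp [symProd, ha.1, ha.2]
        · simp [h1, h2]
  simp only [pd, fderiv_fun_const, Pi.zero_apply, zero_apply]
  linear_combination 3 * this

/-- The tensor `pⱼ (xᵢ pⱼ - xⱼ pᵢ)`. -/
theorem isCompatiblePair_ev_rot {O : Set (Coord n)} {m : ℕ} {i j : Fin n} (hi : i.val < m)
    (hj : ¬ j.val < m) (hne : ∀ x ∈ O, x j ≠ 0) :
    IsCompatiblePair O m (fun _ : Coord n => (ev j : Coord n)) (rot i j) := by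
  intro x hx k l a hkl
  have hij : i ≠ j := fun h => hj (h ▸ hi)
  have hxj := hne x hx
  clear hne
  have li : normalLam m i x = 0 := by simp [normalLam, hi]
  have lj : normalLam m j x = -(1 / x j) := by simp [normalLam, hj]
  rw [pd_symProd (isKillingField_ev j) (isKillingField_rot i j),
    pd_symProd (isKillingField_ev j) (isKillingField_rot i j)]
  simp only [pd_rot, symProd, Matrix.of_apply]
  simp only [rot, pd, fderiv_fun_const, Pi.zero_apply, zero_apply]
  -- The tensor lives in the `(i, j)`-plane, so it only matters whether each of `k`, `l`, `a` is
  -- `i`, `j` or neither. The nontrivial cases balance a derivative of `K` against `3λⱼ = -3/xⱼ`.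
  by_cases hki : k = i <;> by_cases hkj : k = j <;> by_cases hli : l = i <;> by_cases hlj : l = j
    <;> by_cases hai : a = i <;> by_cases haj : a = j <;>
    first
    | (exfalso; exact hij (hki.symm.trans hkj))
    | (exfalso; exact hij (hli.symm.trans hlj))
    | (exfalso; exact hij (hai.symm.trans haj))
    | (exfalso; exact hkl (hki.trans hli.symm))
    | (exfalso; exact hkl (hkj.trans hlj.symm))
    | (subst_vars; simp_all [eq_comm]; done)
    | (subst_vars; simp_all [eq_comm]; field_simp; ring)

/-- The tensor `(xᵢ pⱼ - xⱼ pᵢ)²`. -/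
theorem isCompatiblePair_rot_rot {O : Set (Coord n)} {m : ℕ} {i j : Fin n} (hij : i ≠ j)
    (hi : ¬ i.val < m) (hj : ¬ j.val < m) (hnei : ∀ x ∈ O, x i ≠ 0) (hnej : ∀ x ∈ O, x j ≠ 0) :
    IsCompatiblePair O m (rot i j) (rot i j) := by
  intro x hx k l a hkl
  have hxi := hnei x hx
  have hxj := hnej x hx
  clear hnei hnej
  have li : normalLam m i x = -(1 / x i) := by simp [normalLam, hi]
  have lj : normalLam m j x = -(1 / x j) := by simp [normalLam, hj]
  rw [pd_symProd (isKillingField_rot i j) (isKillingField_rot i j),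
    pd_symProd (isKillingField_rot i j) (isKillingField_rot i j)]
  simp only [pd_rot, symProd, Matrix.of_apply]
  simp only [rot]
  by_cases hki : k = i <;> by_cases hkj : k = j <;> by_cases hli : l = i <;> by_cases hlj : l = j
    <;> by_cases hai : a = i <;> by_cases haj : a = j <;>
    first
    | (exfalso; exact hij (hki.symm.trans hkj))
    | (exfalso; exact hij (hli.symm.trans hlj))
    | (exfalso; exact hij (hai.symm.trans haj))
    | (exfalso; exact hkl (hki.trans hli.symm))
    | (exfalso; exact hkl (hkj.trans hlj.symm))
    | (subst_vars; simp_all [eq_comm]; done)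
    | (subst_vars; simp_all [eq_comm]; field_simp; ring)

/-! ### Potentials of the linking integrals. -/

theorem pd_two_terms {a b α β : ℝ → ℝ} {a' b' α' β' : ℝ} {i j : Fin n} {x : Coord n}
    (ha : HasDerivAt a a' (x i)) (hb : HasDerivAt b b' (x i)) (hα : HasDerivAt α α' (x j))
    (hβ : HasDerivAt β β' (x j)) (k : Fin n) :
    pd k (fun y => a (y i) * α (y j) + b (y i) * β (y j)) x
      = (ev k : Coord n) i * (a' * α (x j) + b' * β (x j))
        + (ev k : Coord n) j * (a (x i) * α' + b (x i) * β') := by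
  have h := (((hasFDerivAt_comp_coord i ha).fun_mul (hasFDerivAt_comp_coord j hα)).fun_add
    ((hasFDerivAt_comp_coord i hb).fun_mul (hasFDerivAt_comp_coord j hβ)))
  simp only [pd, h.fderiv, add_apply, smul_apply, ContinuousLinearMap.proj_apply, smul_eq_mul]
  ring

theorem contDiffAt_two_terms {a b α β : ℝ → ℝ} {i j : Fin n} {x : Coord n}
    (ha : ContDiffAt ℝ ∞ a (x i)) (hb : ContDiffAt ℝ ∞ b (x i)) (hα : ContDiffAt ℝ ∞ α (x j))
    (hβ : ContDiffAt ℝ ∞ β (x j)) :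
    ContDiffAt ℝ ∞ (fun y : Coord n => a (y i) * α (y j) + b (y i) * β (y j)) x := by
  have p : ∀ k, ContDiffAt ℝ ∞ (fun y : Coord n => y k) x :=
    fun k => (contDiff_apply ℝ ℝ k).contDiffAt
  exact ((ha.comp x (p i)).mul (hα.comp x (p j))).add ((hb.comp x (p i)).mul (hβ.comp x (p j)))

theorem hasDerivAt_div_sq (c : ℝ) {s : ℝ} (hs : s ≠ 0) :
    HasDerivAt (fun s : ℝ => c / s ^ 2) (-(2 * c) / s ^ 3) s := by
  refine (hasDerivAt_const s c).fun_div (hasDerivAt_pow 2 s) (pow_ne_zero 2 hs) |>.congr_deriv ?_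
  simp; field_simp

theorem hasDerivAt_const_mul_sq (c s : ℝ) : HasDerivAt (fun s : ℝ => c * s ^ 2) (2 * c * s) s := by
  refine (hasDerivAt_pow 2 s).const_mul c |>.congr_deriv ?_
  simp; ring

theorem contDiffAt_div_sq (c : ℝ) {s : ℝ} (hs : s ≠ 0) :
    ContDiffAt ℝ ∞ (fun s : ℝ => c / s ^ 2) s :=
  contDiffAt_const.div (by fun_prop) (pow_ne_zero 2 hs)

theorem sum_symProd_slope (ξ η : Coord n → Coord n) (x : Coord n) (m : ℕ) (c₀ : ℝ) (c : Fin n → ℝ)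
    (k : Fin n) : ∑ l, symProd ξ η x k l * swSlope m c₀ c l (x l)
      = (ξ x k * (η x ⬝ᵥ fun l => swSlope m c₀ c l (x l))
        + η x k * (ξ x ⬝ᵥ fun l => swSlope m c₀ c l (x l))) / 2 :=
  sum_symProd_mul ξ η x (fun l => swSlope m c₀ c l (x l)) k

/-- `W` is a primitive of `K dV`. The quadratic part of this form is closed precisely because the
coefficients of `xᵢ²` and `xⱼ²` in `V` are in the ratio 4 : 1. The witness is written as two
products of one-variable functions to fit `pd_two_terms`. -/
theorem exists_isLink_ev_rot {O : Set (Coord n)} {m : ℕ} (c₀ : ℝ) (c : Fin n → ℝ) {i j : Fin n}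
    (hi : i.val < m) (hj : ¬ j.val < m) (hne : ∀ x ∈ O, x j ≠ 0) :
    ∃ W, IsLink O m c₀ c i j (fun _ => ev j) (rot i j) W := by
  refine ⟨fun y => y i * (-c₀ * (y j) ^ 2 + c j / (y j) ^ 2) + 1 * (-c i / 4 * (y j) ^ 2),
    isKillingField_ev j, isKillingField_rot i j, fun x hx => ?_, fun x hx k => ?_,
    fun x k hki hkj => by simp [rot, hki, hkj]⟩
  · have h := contDiffAt_div_sq (c j) (hne x hx)
    exact contDiffAt_two_terms (a := fun s => s) (b := fun _ => 1)
      (α := fun s => -c₀ * s ^ 2 + c j / s ^ 2) (β := fun s => -c i / 4 * s ^ 2)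
      (by fun_prop) (by fun_prop) (by fun_prop) (by fun_prop)
  · have hx := hne x hx
    rw [pd_two_terms (a := fun s => s) (b := fun _ => 1)
      (α := fun s => -c₀ * s ^ 2 + c j / s ^ 2) (β := fun s => -c i / 4 * s ^ 2)
      (hasDerivAt_id _) (hasDerivAt_const _ _)
      ((hasDerivAt_const_mul_sq (-c₀) _).fun_add (hasDerivAt_div_sq (c j) hx))
      (hasDerivAt_const_mul_sq (-c i / 4) _), sum_symProd_slope, rot_dotProduct, ev_dotProduct]
    simp only [rot, swSlope, hi, hj, if_true, if_false, ev_apply, eq_comm (a := k)]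
    field_simp
    ring

theorem exists_isLink_rot_rot {O : Set (Coord n)} {m : ℕ} (c₀ : ℝ) (c : Fin n → ℝ) {i j : Fin n}
    (hi : ¬ i.val < m) (hj : ¬ j.val < m) (hnei : ∀ x ∈ O, x i ≠ 0)
    (hnej : ∀ x ∈ O, x j ≠ 0) :
    ∃ W, IsLink O m c₀ c i j (rot i j) (rot i j) W := by
  refine ⟨fun y => c i / (y i) ^ 2 * (1 * (y j) ^ 2) + 1 * (y i) ^ 2 * (c j / (y j) ^ 2),
    isKillingField_rot i j, isKillingField_rot i j, fun x hx => ?_, fun x hx k => ?_,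
    fun x k hki hkj => by simp [rot, hki, hkj]⟩
  · have h := contDiffAt_div_sq (c j) (hnej x hx)
    have h' := contDiffAt_div_sq (c i) (hnei x hx)
    exact contDiffAt_two_terms (a := fun s => c i / s ^ 2) (b := fun s => 1 * s ^ 2)
      (α := fun s => 1 * s ^ 2) (β := fun s => c j / s ^ 2)
      (by fun_prop) (by fun_prop) (by fun_prop) (by fun_prop)
  · have hxi := hnei x hx
    have hxj := hnej x hx
    rw [pd_two_terms (a := fun s => c i / s ^ 2) (b := fun s => 1 * s ^ 2)
      (α := fun s => 1 * s ^ 2) (β := fun s => c j / s ^ 2)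
      (hasDerivAt_div_sq (c i) hxi) (hasDerivAt_const_mul_sq 1 _)
      (hasDerivAt_const_mul_sq 1 _) (hasDerivAt_div_sq (c j) hxj), sum_symProd_slope,
      rot_dotProduct]
    simp only [rot, swSlope, hi, hj, if_false, ev_apply, eq_comm (a := k)]
    field_simp
    ring

theorem exists_isLink_ev_ev {O : Set (Coord n)} {m : ℕ} (c₀ : ℝ) (c : Fin n → ℝ) {i j : Fin n}
    (hi : i.val < m) (hj : j.val < m) :
    ∃ W, IsLink O m c₀ c i j (fun _ => ev i) (fun _ => ev j) W := by
  refine ⟨fun y => y i * (4 * c₀ * y j + c j / 2) + 1 * (c i / 2 * y j),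
    isKillingField_ev i, isKillingField_ev j, fun x hx => ?_, fun x hx k => ?_,
    fun x k hki hkj => by simp [hki, hkj]⟩
  · exact contDiffAt_two_terms (a := fun s => s) (b := fun _ => 1)
      (α := fun s => 4 * c₀ * s + c j / 2) (β := fun s => c i / 2 * s)
      (by fun_prop) (by fun_prop) (by fun_prop) (by fun_prop)
  · rw [pd_two_terms (a := fun s => s) (b := fun _ => 1)
      (α := fun s => 4 * c₀ * s + c j / 2) (β := fun s => c i / 2 * s)
      (hasDerivAt_id _) (hasDerivAt_const _ _)
      (((hasDerivAt_id _).const_mul (4 * c₀)).add_const (c j / 2))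
      ((hasDerivAt_id _).const_mul (c i / 2)), sum_symProd_slope, ev_dotProduct, ev_dotProduct]
    simp only [swSlope, hi, hj, if_true, ev_apply, eq_comm (a := k)]
    ring

/-- When all `λ` vanish, compatible Killing tensors are constant. For constant `V` the differentials
of their integrals then lie in the span of the `dpᵢ`, which has dimension `n < 2n - 1` for `n ≥ 2`.
Angular momenta are therefore needed for the free particle. -/
theorem isLink_ev_rot_of_free (O : Set (Coord n)) {m : ℕ} (hm : ∀ i : Fin n, i.val < m)
    (i j : Fin n) : IsLink O m 0 0 i j (fun _ => ev j) (rot i j) (fun _ => 0) where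
  left := isKillingField_ev j
  right := isKillingField_rot i j
  smooth _ _ := contDiffAt_const
  gradient x _ k := by simp [pd, swSlope, hm]
  supp x k hki hkj := by simp [rot, hki, hkj]

/-! The Jacobians do not vanish identically along suitable lines in phase space. -/

theorem linkDet_ev_rot (m : ℕ) (c₀ : ℝ) (c : Fin n → ℝ) {i j : Fin n} (hij : i ≠ j)
    (z : Coord n × Coord n) :
    linkDet m c₀ c i (fun _ => ev j) (rot i j) z =
      -(swSlope m c₀ c i (z.1 i) * z.1 j * z.2 j) - 2 * z.2 i * z.2 j ^ 2
        + z.2 i * z.1 j * swSlope m c₀ c j (z.1 j) := by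
  unfold linkDet
  rw [sum_symProd_slope, sum_pd_ev, sum_pd_rot, rot_dotProduct, rot_dotProduct, ev_dotProduct,
    ev_dotProduct]
  simp only [rot, ev_apply, hij, hij.symm, if_true, if_false]
  ring

theorem linkDet_rot_rot (m : ℕ) (c₀ : ℝ) (c : Fin n → ℝ) {i j : Fin n} (hij : i ≠ j)
    (z : Coord n × Coord n) :
    linkDet m c₀ c i (rot i j) (rot i j) z =
      -(2 * swSlope m c₀ c i (z.1 i) * z.1 j * (z.1 i * z.2 j - z.1 j * z.2 i))
        - 2 * z.2 i * (2 * z.2 j * (z.1 i * z.2 j - z.1 j * z.2 i)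
          - z.1 j * (z.1 i * swSlope m c₀ c j (z.1 j) - z.1 j * swSlope m c₀ c i (z.1 i))) := by
  unfold linkDet
  rw [sum_symProd_slope, sum_pd_rot, rot_dotProduct, rot_dotProduct]
  simp only [rot, ev_apply, hij, hij.symm, if_true, if_false]
  ring

theorem linkDet_ev_ev (m : ℕ) (c₀ : ℝ) (c : Fin n → ℝ) {i j : Fin n} (hij : i ≠ j)
    (z : Coord n × Coord n) :
    linkDet m c₀ c i (fun _ => ev i) (fun _ => ev j) z =
      swSlope m c₀ c i (z.1 i) * z.2 j - z.2 i * swSlope m c₀ c j (z.1 j) := by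
  unfold linkDet
  rw [sum_symProd_slope, sum_pd_ev, sum_pd_ev]
  simp only [ev_dotProduct]
  simp only [ev_apply, hij, if_true, if_false]
  ring

-- Along the lines used below, each Jacobian is a polynomial of degree at most three in the
-- parameter. A nonzero polynomial has finitely many roots, so it is nonzero close to `0`, apart
-- perhaps from `0` itself.
open Filter Topology in
theorem eventually_cubic_ne_zero {a b c d : ℝ} (h : a ≠ 0 ∨ b ≠ 0 ∨ c ≠ 0 ∨ d ≠ 0) :
    ∀ᶠ t in 𝓝[≠] (0 : ℝ), a * t ^ 3 + b * t ^ 2 + c * t + d ≠ 0 := by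
  let q : Polynomial ℝ := Cubic.toPoly ⟨a, b, c, d⟩
  have hq : q ≠ 0 := by
    intro hq
    have hz := (Cubic.toPoly_eq_zero_iff _).1 hq
    have ha : a = 0 := congrArg Cubic.a hz
    have hb : b = 0 := congrArg Cubic.b hz
    have hc : c = 0 := congrArg Cubic.c hz
    have hd : d = 0 := congrArg Cubic.d hz
    tauto
  have hfin : {t : ℝ | q.eval t = 0}.Finite :=
    (q.roots.toFinset.finite_toSet).subset fun t ht => by simpa [hq] using ht
  have h1 : ({t : ℝ | q.eval t = 0} \ {0}).Finite := hfin.subset Set.sdiff_subset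
  have h2 : ({t : ℝ | q.eval t = 0} \ {0})ᶜ ∈ 𝓝[≠] (0 : ℝ) :=
    nhdsWithin_le_nhds (h1.isClosed.isOpen_compl.mem_nhds (by simp))
  filter_upwards [h2, self_mem_nhdsWithin] with t ht ht0 h0
  refine ht ⟨?_, ht0⟩
  simpa [q, Cubic.toPoly] using h0

-- Given the links, everything reduces to a choice, through each point, of one line along which no
-- Jacobian vanishes identically. Points on that line tending to `z` then prove density.
open Filter Topology in
theorem isSuperintegrableWith_of_isLink {O : Set (Coord n)} {m : ℕ}
    (hne : ∀ y ∈ O, ∀ j : Fin n, ¬ j.val < m → y j ≠ 0) (hO : IsOpen O)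
    {c₀ : ℝ} {c : Fin n → ℝ} (d : ℝ) {j : Fin n} {ξ η : {i // i ≠ j} → Coord n → Coord n}
    {W : {i // i ≠ j} → Coord n → ℝ} (hl : ∀ i : {i // i ≠ j}, IsLink O m c₀ c i j (ξ i) (η i) (W i))
    (hline : ∀ z : Coord n × Coord n, z.1 ∈ O → ∃ v : Coord n × Coord n,
      (∀ i : {i // i ≠ j}, ∀ᶠ t in 𝓝[≠] (0 : ℝ), linkDet m c₀ c i (ξ i) (η i) (z + t • v) ≠ 0) ∧
      ∀ᶠ t in 𝓝[≠] (0 : ℝ), swSlope m c₀ c j ((z + t • v).1 j) ≠ 0 ∨ (z + t • v).2 j ≠ 0)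
    (e : Fin (2 * n - 2) ≃ {i // i ≠ j} ⊕ {i // i ≠ j}) :
    IsSuperintegrableWith O (euclid n) (swPotential m c₀ c d)
      (fun k => Sum.elim (fun i : {i // i ≠ j} => symProd (fun _ => ev i) (fun _ => ev i))
        (fun i => symProd (ξ i) (η i)) (e k))
      (fun k => Sum.elim (fun (i : {i // i ≠ j}) y => swTerm m c₀ c i (y i)) W (e k)) := by
  have dV : ∀ x ∈ O, DifferentiableAt ℝ (swPotential m c₀ c d) x := fun x hx =>
    (hasFDerivAt_swPotential m c₀ c d (hne x hx)).differentiableAt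
  have dW : ∀ i, ∀ x ∈ O, DifferentiableAt ℝ (W i) x := fun i x hx =>
    ((hl i).smooth x hx).differentiableAt (by simp)
  have dT : ∀ i, ∀ x ∈ O, HasFDerivAt (fun y : Coord n => swTerm m c₀ c i (y i)) _ x :=
    fun i x hx => hasFDerivAt_comp_coord i (hasDerivAt_swTerm m c₀ c i (hne x hx i))
  have pT : ∀ i k, ∀ x ∈ O, pd k (fun y : Coord n => swTerm m c₀ c i (y i)) x
      = if k = i then swSlope m c₀ c i (x i) else 0 :=
    fun i k x hx => pd_comp_coord i k (hasDerivAt_swTerm m c₀ c i (hne x hx i))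
  have kil := fun i : Fin n => isKillingField_ev i
  refine ⟨fun k => ?_, fun k => ?_, fun k z hz => ?_, ?_⟩
  · rcases e k with i | i
    · exact isSymTensor_symProd (kil i) (kil i) O
    · exact isSymTensor_symProd (hl i).left (hl i).right O
  · rcases e k with i | i
    · exact fun x hx => ((contDiffAt_swTerm m c₀ c i (hne x hx i)).comp x
        (contDiff_apply ℝ ℝ i.val).contDiffAt).contDiffWithinAt
    · exact fun x hx => ((hl i).smooth x hx).contDiffWithinAt
  · have hz : z.1 ∈ O := hz.1
    rcases e k with i | i
    · refine poisson_quadratic_eq_zero (kil i) (kil i) (dV _ hz) (dT i _ hz).differentiableAt ?_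
      intro k
      simp only [pd_swPotential m c₀ c d (hne _ hz)]
      refine (pT i k _ hz).trans ?_
      rw [sum_symProd_slope]
      by_cases hk : k = i
      · subst hk; simp
      · simp [hk]
    · refine poisson_quadratic_eq_zero (hl i).left (hl i).right (dV _ hz) (dW i _ hz) ?_
      intro k
      simp only [pd_swPotential m c₀ c d (hne _ hz)]
      exact (hl i).gradient _ hz k
  · have indep : ∀ z : Coord n × Coord n, z.1 ∈ O →
        (∀ i : {i // i ≠ j}, linkDet m c₀ c i (ξ i) (η i) z ≠ 0) →
        (swSlope m c₀ c j (z.1 j) ≠ 0 ∨ z.2 j ≠ 0) →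
        LinearIndependent ℝ (fun o : Option (Fin (2 * n - 2)) => fderiv ℝ
          (o.elim (hamiltonian (euclid n) (swPotential m c₀ c d)) fun k => quadratic (euclid n)
            (Sum.elim
              (fun i : {i // i ≠ j} => symProd (fun _ => ev i) (fun _ => ev i)) (fun i => symProd (ξ i) (η i)) (e k))
            (Sum.elim (fun (i : {i // i ≠ j}) y => swTerm m c₀ c i (y i)) W (e k))) z) := by
      intro z hz hdet hj
      have hh := fun (i : {i // i ≠ j}) k =>
        fderiv_quadratic (kil i) (kil i) (z := z) (dT i _ hz).differentiableAt k
      have hF := fun i k => fderiv_quadratic (hl i).left (hl i).right (z := z) (dW i _ hz) k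
      have hH := fun k => fderiv_hamiltonian (z := z) (dV _ hz) k
      simp only [sum_pd_ev, ev_dotProduct, pT _ _ _ hz, pd_swPotential m c₀ c d (hne _ hz)]
        at hh hH
      have key := linearIndependent_option_sum j
        (fderiv ℝ (hamiltonian (euclid n) (swPotential m c₀ c d)) z)
        (fun i : {i // i ≠ j} => fderiv ℝ (quadratic (euclid n)
          (symProd (fun _ => ev i) (fun _ => ev i))
          (fun y => swTerm m c₀ c i (y i))) z)
        (fun i => fderiv ℝ (quadratic (euclid n) (symProd (ξ i) (η i)) (W i)) z)
        (fun k => ((ev k : Coord n), (0 : Coord n))) (fun k => ((0 : Coord n), (ev k : Coord n)))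
        ?_ ?_ ?_ ?_ ?_ ?_ ?_ ?_
      · refine (linearIndependent_equiv' e.optionCongr ?_).2 key
        funext o
        rcases o with _ | k
        · rfl
        · simp only [Function.comp_apply, Equiv.optionCongr_apply, Option.map_some,
            Option.elim_some]
          rcases e k with i | i <;> rfl
      · intro i k hk
        rw [(hh i k).1]; simp [hk]
      · intro i k hk
        rw [(hh i k).2]; simp [hk]
      · intro i k hki hkj
        have hs := fun x => (hl i).supp x k hki hkj
        -- The component `ξₖ` vanishes identically, so the Killing equation turns `∂ₖξₐ` into `-∂ₐξₖ
        -- = 0`: the link does not depend on `xₖ`.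
        have p1 : ∀ a, pd k (fun y => ξ i y a) z.1 = 0 := fun a => by
          have := (hl i).left.killing z.1 a k
          simp only [(hs _).1] at this
          simpa [pd] using this
        have p2 : ∀ a, pd k (fun y => η i y a) z.1 = 0 := fun a => by
          have := (hl i).right.killing z.1 a k
          simp only [(hs _).2] at this
          simpa [pd] using this
        rw [(hF i k).1, (hl i).gradient _ hz, sum_symProd_slope]
        simp [p1, p2, (hs z.1).1, (hs z.1).2]
      · intro i k hki hkj
        have hs := (hl i).supp z.1 k hki hkj
        rw [(hF i k).2]; simp [hs.1, hs.2]
      · intro i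
        rw [(hh i i).1, (hH i).1]; simp
      · intro i
        rw [(hh i i).2, (hH i).2]; simp; ring
      · intro i
        refine ne_of_eq_of_ne ?_ (hdet i)
        rw [(hh i i).1, (hh i i).2, (hF i i).1, (hF i i).2, (hl i).gradient _ hz, linkDet]
        simp only [ev_apply, if_true]
        ring
      · refine hj.imp (fun h => ?_) fun h => ?_
        · rw [(hH j).1]; exact h
        · rw [(hH j).2]; exact mul_ne_zero two_ne_zero h
    rintro z ⟨hz, -⟩
    obtain ⟨v, hv1, hv2⟩ := hline z hz
    have hcont : Tendsto (fun t : ℝ => z + t • v) (𝓝[≠] 0) (𝓝 z) := by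
      have : Continuous fun t : ℝ => z + t • v := by fun_prop
      simpa using (this.tendsto 0).mono_left nhdsWithin_le_nhds
    refine mem_closure_of_tendsto hcont ?_
    have hmem : ∀ᶠ t in 𝓝[≠] (0 : ℝ), (z + t • v).1 ∈ O :=
      hcont.eventually ((hO.preimage continuous_fst).mem_nhds hz)
    filter_upwards [eventually_all.2 hv1, hv2, hmem] with t h1 h2 h3
    exact ⟨⟨h3, Set.mem_univ _⟩, indep _ h3 h1 h2⟩

theorem nonempty_equiv_sum_ne (j : Fin n) :
    Nonempty (Fin (2 * n - 2) ≃ {i // i ≠ j} ⊕ {i // i ≠ j}) := by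
  refine ⟨(Fintype.equivFinOfCardEq ?_).symm⟩
  rw [Fintype.card_sum, Fintype.card_subtype_compl, Fintype.card_fin, Fintype.card_subtype_eq]
  omega

/-- Superintegrability through compatible Killing tensors when the product does not vanish. -/
theorem exists_isSuperintegrableWith_of_lt {O : Set (Coord n)} {m : ℕ} (hmn : m < n)
    (hne : ∀ y ∈ O, ∀ j : Fin n, ¬ j.val < m → y j ≠ 0) (hO : IsOpen O)
    (c₀ : ℝ) (c : Fin n → ℝ) (d : ℝ) :
    ∃ (K : Fin (2 * n - 2) → TwoTensor n) (W : Fin (2 * n - 2) → Coord n → ℝ),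
      (∀ k, IsCompatibleKilling O (euclid n) (diagProduct (normalLam m)) (K k)) ∧
      IsSuperintegrableWith O (euclid n) (swPotential m c₀ c d) K W := by
  classical
  -- Since `m < n`, the last index is singular; both kinds of link need a singular partner.
  let j : Fin n := ⟨n - 1, by omega⟩
  have hj : ¬ j.val < m := by simp only [j]; omega
  let ξ : {i // i ≠ j} → Coord n → Coord n :=
    fun i => if i.val.val < m then fun _ => ev j else rot i j
  have hW : ∀ i : {i // i ≠ j}, ∃ W, IsLink O m c₀ c i j (ξ i) (rot i j) W := by
    intro i
    by_cases hi : i.val.val < m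
    · simp only [ξ, hi, if_true]
      exact exists_isLink_ev_rot c₀ c hi hj fun x hx => hne x hx j hj
    · simp only [ξ, hi, if_false]
      exact exists_isLink_rot_rot c₀ c hi hj (fun x hx => hne x hx i hi)
        fun x hx => hne x hx j hj
  choose W hl using hW
  obtain ⟨e⟩ := nonempty_equiv_sum_ne j
  refine ⟨_, _, fun k => ?_, isSuperintegrableWith_of_isLink hne hO d hl ?_ e⟩
  · rcases e k with i | i
    · exact isCompatibleKilling_symProd (isKillingField_ev _) (isKillingField_ev _)
        (isCompatiblePair_self O m i)
    · refine isCompatibleKilling_symProd (hl i).left (hl i).right ?_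
      by_cases hi : i.val.val < m
      · simp only [ξ, hi, if_true]
        exact isCompatiblePair_ev_rot hi hj fun x hx => hne x hx j hj
      · simp only [ξ, hi, if_false]
        exact isCompatiblePair_rot_rot i.2 hi hj (fun x hx => hne x hx i hi)
          fun x hx => hne x hx j hj
  · rintro ⟨x, p⟩ hx
    have hxj := hne x hx j hj
    -- Only momenta move, so the slopes of the potential stay fixed. For singular `i` the cubic
    -- coefficient is `-4vᵢvⱼ(xᵢvⱼ - xⱼvᵢ)`. With `vⱼ = 1` and `vᵢ = 2xᵢ/xⱼ` the last factor is
    -- `-xᵢ`; the factor `2` keeps `v` off the direction of `x`, where it would vanish.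
    refine ⟨(0, fun k => if k.val < m ∨ k = j then 1 else 2 * x k / x j), fun i => ?_, ?_⟩
    · by_cases hi : i.val.val < m
      · simp only [ξ, hi, if_true, linkDet_ev_rot m c₀ c i.2]
        generalize hSi : swSlope m c₀ c i = Si
        generalize hSj : swSlope m c₀ c j = Sj
        refine (eventually_cubic_ne_zero (a := -2) (b := -2 * (p i + 2 * p j))
          (c := -(Si (x i) * x j) - 2 * (p j ^ 2 + 2 * p i * p j) + x j * Sj (x j))
          (d := -(Si (x i) * x j * p j) - 2 * p i * p j ^ 2 + p i * x j * Sj (x j))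
          (Or.inl (by norm_num))).mono fun t ht => ?_
        convert ht using 1
        simp [hi]
        ring
      · have hxi := hne x hx i hi
        simp only [ξ, hi, if_false, linkDet_rot_rot m c₀ c i.2]
        generalize hSi : swSlope m c₀ c i = Si
        generalize hSj : swSlope m c₀ c j = Sj
        have hr : x j * (2 * x i / x j) = 2 * x i := by field_simp
        have hr0 : 2 * x i / x j ≠ 0 := div_ne_zero (mul_ne_zero two_ne_zero hxi) hxj
        refine (eventually_cubic_ne_zero (a := 4 * (2 * x i / x j) * x i)
          (b := -4 * ((2 * x i / x j) * (x i * p j - x j * p i)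
            - (p i + 2 * x i / x j * p j) * x i))
          (c := -4 * ((p i + 2 * x i / x j * p j) * (x i * p j - x j * p i) - p i * p j * x i)
            + 2 * (2 * x i / x j) * (x j * (x i * Sj (x j) - x j * Si (x i)))
            + 2 * Si (x i) * x j * x i)
          (d := -4 * (p i * p j * (x i * p j - x j * p i))
            + 2 * p i * (x j * (x i * Sj (x j) - x j * Si (x i)))
            - 2 * Si (x i) * x j * (x i * p j - x j * p i))
          (Or.inl (mul_ne_zero (mul_ne_zero four_ne_zero hr0) hxi))).mono fun t ht => ?_
        convert ht using 1
        generalize hr1 : 2 * x i / x j = r at hr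
        simp only [Prod.fst_add, Prod.snd_add, Prod.smul_fst, Prod.smul_snd, Pi.add_apply,
          Pi.smul_apply, smul_eq_mul, smul_zero, Pi.zero_apply, add_zero, hi, i.2, or_self,
          if_false, or_true, if_true, mul_one, hr1]
        -- Eliminating `xᵢ` in favour of `r = 2xᵢ/xⱼ` leaves an identity of polynomials, without
        -- division by `xⱼ`.
        have hr2 : x i = x j * r / 2 := by rw [hr]; ring
        generalize Si (x i) = si
        generalize Sj (x j) = sj
        rw [hr2]
        ring
    · refine (eventually_cubic_ne_zero (a := 0) (b := 0) (c := 1) (d := p j) (by simp)).mono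
        fun t ht => Or.inr ?_
      convert ht using 1
      simp
      ring

/-- Superintegrability through compatible Killing tensors when the product vanishes and the
potential is not constant. -/
theorem exists_isSuperintegrableWith_of_ne_zero (O : Set (Coord n)) (hO : IsOpen O) (hn : n ≠ 0)
    {c₀ : ℝ} {c : Fin n → ℝ} (h : c₀ ≠ 0 ∨ c ≠ 0) (d : ℝ) :
    ∃ (K : Fin (2 * n - 2) → TwoTensor n) (W : Fin (2 * n - 2) → Coord n → ℝ),
      (∀ k, IsCompatibleKilling O (euclid n) (diagProduct (normalLam n)) (K k)) ∧
      IsSuperintegrableWith O (euclid n) (swPotential n c₀ c d) K W := by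
  obtain ⟨j, hj⟩ : ∃ j, c₀ ≠ 0 ∨ c j ≠ 0 := by
    rcases h with h | h
    · exact ⟨⟨0, by omega⟩, Or.inl h⟩
    · obtain ⟨j, hj⟩ := Function.ne_iff.1 h
      exact ⟨j, Or.inr hj⟩
  have hne : ∀ y ∈ O, ∀ j : Fin n, ¬ j.val < n → y j ≠ 0 := fun _ _ j hj => (hj j.2).elim
  have hW : ∀ i : {i // i ≠ j}, ∃ W, IsLink O n c₀ c i j (fun _ => ev i) (fun _ => ev j) W :=
    fun i => exists_isLink_ev_ev c₀ c i.val.2 j.2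
  choose W hl using hW
  obtain ⟨e⟩ := nonempty_equiv_sum_ne j
  refine ⟨_, _, fun k => ?_, isSuperintegrableWith_of_isLink hne hO d hl ?_ e⟩
  · rcases e k with i | i
    · exact isCompatibleKilling_symProd (isKillingField_ev _) (isKillingField_ev _)
        (isCompatiblePair_self O n i)
    · exact isCompatibleKilling_symProd (isKillingField_ev _) (isKillingField_ev _)
        (isCompatiblePair_ev_ev O n i.val.2 j.2)
  · rintro ⟨x, p⟩ hx
    -- Here `xⱼ` must move: `pⱼ` stays fixed and may be zero, so the differential of `H` in the
    -- `j`-plane has to be detected by the slope of `Vⱼ`. Either `c₀ ≠ 0` gives a quadratic term in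
    -- the Jacobian, or `cⱼ ≠ 0` gives a linear one.
    refine ⟨(ev j, fun k => if k = j then 0 else 1), fun i => ?_, ?_⟩
    · refine (eventually_cubic_ne_zero (a := 0) (b := -(8 * c₀))
          (c := -(8 * c₀ * x j + c j + 8 * c₀ * p i))
          (d := (8 * c₀ * x i + c i) * p j - p i * (8 * c₀ * x j + c j))
          ?_).mono fun t ht => ?_
      · by_cases h0 : c₀ = 0
        · subst h0
          simp only [ne_eq, not_true_eq_false, false_or] at hj
          exact Or.inr (Or.inr (Or.inl (by simpa using hj)))
        · exact Or.inr (Or.inl (by simpa using h0))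
      · rw [linkDet_ev_ev n c₀ c i.2]
        convert ht using 1
        simp [swSlope, i.2]
        ring
    · refine (eventually_cubic_ne_zero (a := 0) (b := 0) (c := 8 * c₀) (d := 8 * c₀ * x j + c j)
        ?_).mono fun t ht => Or.inl ?_
      · by_cases h0 : c₀ = 0
        · subst h0; simpa using hj
        · exact Or.inr (Or.inr (Or.inl (by simpa using h0)))
      · convert ht using 1
        simp [swSlope]
        ring

/-- Superintegrability of the free particle. -/
theorem isSuperintegrable_free (O : Set (Coord n)) (hO : IsOpen O) (hn : n ≠ 0) (d : ℝ) :
    IsSuperintegrable O (euclid n) (swPotential n 0 0 d) := by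
  have hne : ∀ y ∈ O, ∀ j : Fin n, ¬ j.val < n → y j ≠ 0 := fun _ _ j hj => (hj j.2).elim
  let j : Fin n := ⟨0, by omega⟩
  obtain ⟨e⟩ := nonempty_equiv_sum_ne j
  refine ⟨_, _, isSuperintegrableWith_of_isLink hne hO d
    (fun i : {i // i ≠ j} => isLink_ev_rot_of_free O (fun i => i.2) i j) ?_ e⟩
  rintro ⟨x, p⟩ hx
  refine ⟨(0, fun _ => 1), fun i => ?_, ?_⟩
  · refine (eventually_cubic_ne_zero (a := -2) (b := -2 * (p i + 2 * p j))
      (c := - 2 * (p j ^ 2 + 2 * p i * p j)) (d := - 2 * p i * p j ^ 2)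
      (Or.inl (by norm_num))).mono fun t ht => ?_
    rw [linkDet_ev_rot n 0 0 i.2]
    convert ht using 1
    simp [swSlope]
    ring
  · refine (eventually_cubic_ne_zero (a := 0) (b := 0) (c := 1) (d := p j) (by simp)).mono
      fun t ht => Or.inr ?_
    convert ht using 1
    simp
    ring

/-! Flat coordinates. -/

variable {Φ : OpenPartialHomeomorph (Coord n) (Coord n)}

theorem IsCoordChange.differentiableAt (hΦ : IsCoordChange Φ) {x : Coord n} (hx : x ∈ Φ.source) :
    DifferentiableAt ℝ Φ x :=
  (hΦ.smooth.contDiffAt (Φ.open_source.mem_nhds hx)).differentiableAt (by simp)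

theorem IsCoordChange.symm (hΦ : IsCoordChange Φ) : IsCoordChange Φ.symm :=
  ⟨hΦ.smooth_symm, by simpa using hΦ.smooth⟩

theorem IsCoordChange.fderiv_symm_fderiv (hΦ : IsCoordChange Φ) {x : Coord n}
    (hx : x ∈ Φ.source) (X : Coord n) : fderiv ℝ Φ.symm (Φ x) (fderiv ℝ Φ x X) = X := by
  have h1 := (hΦ.symm.differentiableAt (Φ.map_source hx)).hasFDerivAt.comp x
    (hΦ.differentiableAt hx).hasFDerivAt
  have h2 : Φ.symm ∘ Φ =ᶠ[nhds x] id := by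
    filter_upwards [Φ.open_source.mem_nhds hx] with y hy using Φ.left_inv hy
  have h3 := (h1.congr_of_eventuallyEq h2.symm).unique (hasFDerivAt_id x)
  exact congrArg (fun L : Coord n →L[ℝ] Coord n => L X) h3

theorem IsCoordChange.fderiv_fderiv_symm (hΦ : IsCoordChange Φ) {y : Coord n}
    (hy : y ∈ Φ.target) (Y : Coord n) : fderiv ℝ Φ (Φ.symm y) (fderiv ℝ Φ.symm y Y) = Y := by
  simpa using hΦ.symm.fderiv_symm_fderiv (x := y) hy Y

theorem IsCoordChange.fderiv_surjective (hΦ : IsCoordChange Φ) {x : Coord n}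
    (hx : x ∈ Φ.source) : Function.Surjective (fderiv ℝ Φ x) := fun Y =>
  ⟨fderiv ℝ Φ.symm (Φ x) Y, by
    simpa [Φ.left_inv hx] using hΦ.fderiv_fderiv_symm (Φ.map_source hx) Y⟩

/-- The coordinate fields in the new coordinates are smooth. -/
theorem IsCoordChange.contDiffOn_fderiv (hΦ : IsCoordChange Φ) :
    ContDiffOn ℝ ∞ (fderiv ℝ Φ) Φ.source :=
  hΦ.smooth.fderiv_of_isOpen Φ.open_source (m := ∞) (by simp)

theorem IsCoordChange.differentiableAt_fderiv (hΦ : IsCoordChange Φ) {x : Coord n}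
    (hx : x ∈ Φ.source) : DifferentiableAt ℝ (fderiv ℝ Φ) x :=
  (hΦ.contDiffOn_fderiv.contDiffAt (Φ.open_source.mem_nhds hx)).differentiableAt (by simp)

theorem IsCoordChange.hasFDerivAt_fderiv_apply (hΦ : IsCoordChange Φ) {x : Coord n}
    (hx : x ∈ Φ.source) (v : Coord n) :
    HasFDerivAt (fun y => fderiv ℝ Φ y v) ((fderiv ℝ (fderiv ℝ Φ) x).flip v) x := by
  have := (hΦ.differentiableAt_fderiv hx).hasFDerivAt.clm_apply (hasFDerivAt_const v x)
  simpa using this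

theorem IsCoordChange.second_fderiv_comm (hΦ : IsCoordChange Φ) {x : Coord n}
    (hx : x ∈ Φ.source) (v w : Coord n) :
    fderiv ℝ (fderiv ℝ Φ) x v w = fderiv ℝ (fderiv ℝ Φ) x w v :=
  (hΦ.smooth.contDiffAt (Φ.open_source.mem_nhds hx)).isSymmSndFDerivAt
    (by simpa using WithTop.coe_le_coe.2 (le_top : (2 : ℕ∞) ≤ ⊤)) v w

theorem hasFDerivAt_dotProduct {u v : Coord n → Coord n} {u' v' : Coord n →L[ℝ] Coord n}
    {x : Coord n} (hu : HasFDerivAt u u' x) (hv : HasFDerivAt v v' x) :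
    DifferentiableAt ℝ (fun y => u y ⬝ᵥ v y) x ∧
    ∀ w, fderiv ℝ (fun y => u y ⬝ᵥ v y) x w = u' w ⬝ᵥ v x + u x ⬝ᵥ v' w := by
  have h : HasFDerivAt (fun y => u y ⬝ᵥ v y) _ x := HasFDerivAt.fun_sum fun i _ =>
    ((hasFDerivAt_pi'.1 hu) i).fun_mul ((hasFDerivAt_pi'.1 hv) i)
  refine ⟨h.differentiableAt, fun w => ?_⟩
  rw [h.fderiv]
  simp only [sum_apply, add_apply, smul_apply, ContinuousLinearMap.comp_apply,
    ContinuousLinearMap.proj_apply, smul_eq_mul, dotProduct, ← Finset.sum_add_distrib]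
  exact Finset.sum_congr rfl fun i _ => by ring

/-- In flat coordinates `Φ`, the Christoffel symbols are given by the second derivatives of `Φ`. -/
theorem fderiv_christoffel {U : Set (Coord n)} {g : TwoTensor n} (hg : IsRiemannianMetric U g)
    (hΦ : IsCoordChange Φ) (hU : Φ.source ⊆ U) (hT : TransformsMetric Φ g (euclid n))
    {x : Coord n} (hx : x ∈ Φ.source) (i j : Fin n) :
    fderiv ℝ Φ x (fun k => christoffel g k i j x) = fderiv ℝ (fderiv ℝ Φ) x (ev i) (ev j) := by
  have hpd : ∀ a b c : Fin n, pd a (fun y => g y b c) x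
      = fderiv ℝ (fderiv ℝ Φ) x (ev a) (ev b) ⬝ᵥ fderiv ℝ Φ x (ev c)
        + fderiv ℝ Φ x (ev b) ⬝ᵥ fderiv ℝ (fderiv ℝ Φ) x (ev a) (ev c) := by
    intro a b c
    have hE : Set.EqOn (fun y => g y b c)
        (fun y => fderiv ℝ Φ y (ev b) ⬝ᵥ fderiv ℝ Φ y (ev c)) Φ.source := fun y hy => by
      have := hT y hy (ev b) (ev c)
      simpa [euclid_apply, Matrix.mulVec, ev, dotProduct_single] using this
    rw [pd_congr Φ.open_source hE hx, pd, (hasFDerivAt_dotProduct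
      (hΦ.hasFDerivAt_fderiv_apply hx (ev b)) (hΦ.hasFDerivAt_fderiv_apply hx (ev c))).2]
    simp
  -- By symmetry of `D²Φ`, the six terms from the three metric derivatives collapse to twice a
  -- single one.
  have hw : (fun k => christoffel g k i j x) = (g x)⁻¹ *ᵥ
      fun l => fderiv ℝ (fderiv ℝ Φ) x (ev i) (ev j) ⬝ᵥ fderiv ℝ Φ x (ev l) := by
    ext k
    change christoffel g k i j x = ∑ l, (g x)⁻¹ k l *
      (fderiv ℝ (fderiv ℝ Φ) x (ev i) (ev j) ⬝ᵥ fderiv ℝ Φ x (ev l))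
    simp only [christoffel, hpd]
    rw [Finset.mul_sum]
    refine Finset.sum_congr rfl fun l _ => ?_
    rw [hΦ.second_fderiv_comm hx (ev j) (ev i), hΦ.second_fderiv_comm hx (ev l) (ev i),
      hΦ.second_fderiv_comm hx (ev l) (ev j),
      dotProduct_comm (fderiv ℝ Φ x (ev j)), dotProduct_comm (fderiv ℝ Φ x (ev i))]
    ring
  have hdet : IsUnit (g x).det := isUnit_iff_ne_zero.2 (hg.posDef x (hU hx)).det_pos.ne'
  -- Pairing through `g` cancels `g⁻¹`. As `DΦ` is surjective, the difference turns out to be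
  -- orthogonal to itself.
  have key : ∀ Y : Coord n, fderiv ℝ Φ x Y ⬝ᵥ (fderiv ℝ Φ x (fun k => christoffel g k i j x)
      - fderiv ℝ (fderiv ℝ Φ) x (ev i) (ev j)) = 0 := by
    intro Y
    have h1 := hT x hx Y (fun k => christoffel g k i j x)
    rw [hw, Matrix.mulVec_mulVec, Matrix.mul_nonsing_inv _ hdet, ← hw] at h1
    simp only [euclid_apply, Matrix.one_mulVec] at h1
    rw [dotProduct_sub, ← h1, dotProduct_comm (fderiv ℝ Φ x Y)]
    conv_lhs => rw [eq_sum_smul_ev Y]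
    simp only [map_sum, map_smul, dotProduct_sum, dotProduct_smul, sum_dotProduct, smul_dotProduct,
      ev_dotProduct]
    simp
  obtain ⟨Y, hY⟩ := hΦ.fderiv_surjective hx (fderiv ℝ Φ x (fun k => christoffel g k i j x)
      - fderiv ℝ (fderiv ℝ Φ) x (ev i) (ev j))
  have := key Y
  rw [hY, dotProduct_self_eq_zero] at this
  exact sub_eq_zero.1 this

/-! ### The product and its structure equation in flat coordinates. -/

/-- A bilinear product as a continuous bilinear map. -/
noncomputable def bilinCLM (b : Coord n →ₗ[ℝ] Coord n →ₗ[ℝ] Coord n) :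
    Coord n →L[ℝ] Coord n →L[ℝ] Coord n :=
  LinearMap.toContinuousLinearMap (LinearMap.toContinuousLinearMap.toLinearMap ∘ₗ b)

@[simp]
theorem bilinCLM_apply (b : Coord n →ₗ[ℝ] Coord n →ₗ[ℝ] Coord n) (X Y : Coord n) :
    bilinCLM b X Y = b X Y := rfl

/-- The product `star` in the new coordinates. -/
noncomputable def pushProduct (Φ : OpenPartialHomeomorph (Coord n) (Coord n)) (star : Product n) :
    Product n := fun y =>
  ((star (Φ.symm y)).compl₁₂ (fderiv ℝ Φ.symm y).toLinearMap (fderiv ℝ Φ.symm y).toLinearMap).compr₂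
    (fderiv ℝ Φ (Φ.symm y)).toLinearMap

theorem pushProduct_apply (star : Product n) (y X Y : Coord n) :
    pushProduct Φ star y X Y = fderiv ℝ Φ (Φ.symm y)
      (star (Φ.symm y) (fderiv ℝ Φ.symm y X) (fderiv ℝ Φ.symm y Y)) := rfl

theorem transformsProduct_pushProduct (hΦ : IsCoordChange Φ) (star : Product n) :
    TransformsProduct Φ star (pushProduct Φ star) := by
  intro x hx X Y
  rw [pushProduct_apply, hΦ.fderiv_symm_fderiv hx, hΦ.fderiv_symm_fderiv hx, Φ.left_inv hx]

theorem product_apply_eq_sum (star : Product n) (x X Y : Coord n) (k : Fin n) :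
    star x X Y k = ∑ i, ∑ j, X i * Y j * coeff star k i j x := by
  conv_lhs => rw [eq_sum_smul_ev X, eq_sum_smul_ev Y]
  simp only [map_sum, map_smul, LinearMap.sum_apply, LinearMap.smul_apply,
    Finset.sum_apply, Pi.smul_apply, smul_eq_mul, coeff]
  rw [Finset.sum_comm]
  simp only [Finset.mul_sum]
  exact Finset.sum_congr rfl fun _ _ => Finset.sum_congr rfl fun _ _ => by ring

theorem contDiffOn_pushProduct (hΦ : IsCoordChange Φ) {U : Set (Coord n)} (hU : Φ.source ⊆ U)
    {star : Product n} (hs : ∀ k i j, ContDiffOn ℝ ∞ (coeff star k i j) U) :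
    ContDiffOn ℝ ∞ (fun y => bilinCLM (pushProduct Φ star y)) Φ.target := by
  have hD : ContDiffOn ℝ ∞ (fderiv ℝ Φ.symm) Φ.target := hΦ.symm.contDiffOn_fderiv
  have hD' : ContDiffOn ℝ ∞ (fun y => fderiv ℝ Φ (Φ.symm y)) Φ.target :=
    hΦ.contDiffOn_fderiv.comp hΦ.smooth_symm fun y hy => Φ.map_target hy
  have hX : ∀ (X : Coord n) (i : Fin n),
      ContDiffOn ℝ ∞ (fun y => fderiv ℝ Φ.symm y X i) Φ.target := fun X i =>
    contDiffOn_pi.1 (hD.clm_apply contDiffOn_const) i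
  rw [contDiffOn_clm_apply]
  intro X
  rw [contDiffOn_clm_apply]
  intro Y
  simp only [bilinCLM_apply, pushProduct_apply]
  refine hD'.clm_apply (contDiffOn_pi.2 fun k => ?_)
  simp only [product_apply_eq_sum]
  exact ContDiffOn.sum fun i _ => ContDiffOn.sum fun j _ => ((hX X i).mul (hX Y j)).mul
    (((hs k i j).mono hU).comp hΦ.smooth_symm fun y hy => Φ.map_target hy)

theorem eq_of_eq_basis {F : Type*} [AddCommGroup F] [Module ℝ F] {f h : Coord n → F}
    (hf : IsLinearMap ℝ f) (hh : IsLinearMap ℝ h) (b : Module.Basis (Fin n) ℝ (Coord n))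
    (e : ∀ i, f (b i) = h (b i)) (X : Coord n) : f X = h X := by
  have : hf.mk' f = hh.mk' h := b.ext e
  exact congrArg (fun L : Coord n →ₗ[ℝ] F => L X) this

theorem eq_of_eq_ev {F : Type*} [AddCommGroup F] [Module ℝ F] {f h : Coord n → F}
    (hf : IsLinearMap ℝ f) (hh : IsLinearMap ℝ h) (e : ∀ i, f (ev i) = h (ev i)) (X : Coord n) :
    f X = h X :=
  eq_of_eq_basis hf hh (Pi.basisFun ℝ (Fin n)) (by simpa [ev] using e) X

/-- Differentiating `DΦ(∂ᵢ ⋆ ∂ⱼ) = P(DΦ ∂ᵢ, DΦ ∂ⱼ)` along `∂ₗ` produces terms in `D²Φ`. By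
`fderiv_christoffel` these are the images of the Christoffel terms in `∇⋆`, so they cancel. -/
theorem fderiv_of_transformsProduct {U : Set (Coord n)} {g : TwoTensor n}
    (hg : IsRiemannianMetric U g) {star : Product n} (hHF : IsHesseFrobenius U g star)
    (hΦ : IsCoordChange Φ) (hU : Φ.source ⊆ U) (hT : TransformsMetric Φ g (euclid n))
    {P : Coord n → (Coord n →L[ℝ] Coord n →L[ℝ] Coord n)}
    (hPush : ∀ x ∈ Φ.source, ∀ X Y,
      fderiv ℝ Φ x (star x X Y) = P (Φ x) (fderiv ℝ Φ x X) (fderiv ℝ Φ x Y))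
    {x : Coord n} (hx : x ∈ Φ.source) (hP : DifferentiableAt ℝ P (Φ x)) (X Y Z : Coord n) :
    fderiv ℝ P (Φ x) Z X Y = P (Φ x) (P (Φ x) X Y) Z := by
  have hPd : HasFDerivAt (fun y => P (Φ y)) ((fderiv ℝ P (Φ x)).comp (fderiv ℝ Φ x)) x :=
    HasFDerivAt.comp (g := P) (f := Φ) x hP.hasFDerivAt (hΦ.differentiableAt hx).hasFDerivAt
  have basis : ∀ l i j, fderiv ℝ P (Φ x) (fderiv ℝ Φ x (ev l)) (fderiv ℝ Φ x (ev i))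
      (fderiv ℝ Φ x (ev j))
      = P (Φ x) (P (Φ x) (fderiv ℝ Φ x (ev i)) (fderiv ℝ Φ x (ev j))) (fderiv ℝ Φ x (ev l)) := by
    intro l i j
    have hF : HasFDerivAt (fun y => ∑ k, coeff star k i j y • fderiv ℝ Φ y (ev k)) _ x :=
      HasFDerivAt.fun_sum fun k _ =>
        ((((hHF.smooth k i j).mono hU).contDiffAt (Φ.open_source.mem_nhds hx)).differentiableAt
          (by simp)).hasFDerivAt.fun_smul (hΦ.hasFDerivAt_fderiv_apply hx (ev k))
    have hG := (hPd.clm_apply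
      (hΦ.hasFDerivAt_fderiv_apply hx (ev i))).clm_apply (hΦ.hasFDerivAt_fderiv_apply hx (ev j))
    have hFG : (fun y => ∑ k, coeff star k i j y • fderiv ℝ Φ y (ev k)) =ᶠ[nhds x]
        fun y => P (Φ y) (fderiv ℝ Φ y (ev i)) (fderiv ℝ Φ y (ev j)) := by
      filter_upwards [Φ.open_source.mem_nhds hx] with y hy
      have := hPush y hy (ev i) (ev j)
      rw [eq_sum_smul_ev (star y (ev i) (ev j)), map_sum] at this
      simpa [coeff] using this
    have hE := congrArg (fun L : Coord n →L[ℝ] Coord n => L (ev l))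
      ((hF.congr_of_eventuallyEq hFG.symm).unique hG)
    have hΓ := fun a b => fderiv_christoffel hg hΦ hU hT hx a b
    -- The Hesse-Frobenius condition solved for the partial derivatives of the coefficients, as a
    -- vector identity to which `DΦ` is applied.
    have hvec : ∑ k, pd l (coeff star k i j) x • fderiv ℝ Φ x (ev k)
        = fderiv ℝ Φ x (star x (star x (ev i) (ev j)) (ev l)
          - ∑ a, coeff star a i j x • (fun k => christoffel g k l a x)
          + star x (fun k => christoffel g k l i x) (ev j)
          + star x (ev i) (fun k => christoffel g k l j x)) := by
      simp only [← map_smul, ← map_sum]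
      congr 1
      ext k
      have h1 := hHF.differential x (hU hx) l k i j
      have h2 : star x (fun k => christoffel g k l i x) (ev j) k
          = ∑ a, christoffel g a l i x * coeff star k a j x := by
        conv_lhs => rw [eq_sum_smul_ev fun k => christoffel g k l i x]
        simp [coeff, Finset.sum_apply]
      have h3 : star x (ev i) (fun k => christoffel g k l j x) k
          = ∑ a, christoffel g a l j x * coeff star k i a x := by
        conv_lhs => rw [eq_sum_smul_ev fun k => christoffel g k l j x]
        simp [coeff, Finset.sum_apply]
      have h4 : (∑ a, coeff star a i j x • (fun k => christoffel g k l a x)) k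
          = ∑ a, christoffel g k l a x * coeff star a i j x := by
        simp [Finset.sum_apply, mul_comm]
      simp only [covDerivProduct] at h1
      simp only [Pi.add_apply, Pi.sub_apply, h2, h3, h4, ← h1]
      simp only [Finset.sum_apply, Pi.smul_apply, ev_apply, smul_eq_mul, mul_ite, mul_one, mul_zero,
        Finset.sum_ite_eq, Finset.mem_univ, if_true]
      ring
    simp only [sum_apply, add_apply, smul_apply,
      ContinuousLinearMap.smulRight_apply, ContinuousLinearMap.comp_apply,
      ContinuousLinearMap.flip_apply, Finset.sum_add_distrib] at hE
    have hE2 : ∑ k, (fderiv ℝ (coeff star k i j) x) (ev l) • fderiv ℝ Φ x (ev k)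
        = ∑ k, pd l (coeff star k i j) x • fderiv ℝ Φ x (ev k) := rfl
    rw [hE2, hvec] at hE
    simp only [map_add, map_sub, map_sum, map_smul, hPush x hx, hΓ] at hE
    have := sub_eq_zero.2 hE
    rw [← sub_eq_zero, ← neg_eq_zero, ← this]
    abel
  have ext3 : ∀ w u v, fderiv ℝ P (Φ x) (fderiv ℝ Φ x w) (fderiv ℝ Φ x u) (fderiv ℝ Φ x v)
      = P (Φ x) (P (Φ x) (fderiv ℝ Φ x u) (fderiv ℝ Φ x v)) (fderiv ℝ Φ x w) := by
    intro w u v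
    refine eq_of_eq_ev (f := fun w => fderiv ℝ P (Φ x) (fderiv ℝ Φ x w) (fderiv ℝ Φ x u)
      (fderiv ℝ Φ x v)) (h := fun w => P (Φ x) (P (Φ x) (fderiv ℝ Φ x u) (fderiv ℝ Φ x v))
      (fderiv ℝ Φ x w)) ⟨by intros; simp, by intros; simp⟩ ⟨by intros; simp, by intros; simp⟩
      (fun l => ?_) w
    refine eq_of_eq_ev (f := fun u => fderiv ℝ P (Φ x) (fderiv ℝ Φ x (ev l)) (fderiv ℝ Φ x u)
      (fderiv ℝ Φ x v)) (h := fun u => P (Φ x) (P (Φ x) (fderiv ℝ Φ x u) (fderiv ℝ Φ x v))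
      (fderiv ℝ Φ x (ev l))) ⟨by intros; simp, by intros; simp⟩ ⟨by intros; simp, by intros; simp⟩
      (fun i => ?_) u
    exact eq_of_eq_ev (f := fun v => fderiv ℝ P (Φ x) (fderiv ℝ Φ x (ev l)) (fderiv ℝ Φ x (ev i))
      (fderiv ℝ Φ x v)) (h := fun v => P (Φ x) (P (Φ x) (fderiv ℝ Φ x (ev i)) (fderiv ℝ Φ x v))
      (fderiv ℝ Φ x (ev l))) ⟨by intros; simp, by intros; simp⟩ ⟨by intros; simp, by intros; simp⟩
      (fun j => basis l i j) v
  obtain ⟨u, rfl⟩ := hΦ.fderiv_surjective hx X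
  obtain ⟨v, rfl⟩ := hΦ.fderiv_surjective hx Y
  obtain ⟨w, rfl⟩ := hΦ.fderiv_surjective hx Z
  exact ext3 w u v

/-- In flat coordinates the Hesse-Frobenius condition reads `D_Z ⋆ (X, Y) = X ⋆ Y ⋆ Z`. -/
theorem fderiv_pushProduct {U : Set (Coord n)} {g : TwoTensor n} (hg : IsRiemannianMetric U g)
    {star : Product n} (hHF : IsHesseFrobenius U g star)
    (hΦ : IsCoordChange Φ) (hU : Φ.source ⊆ U) (hT : TransformsMetric Φ g (euclid n))
    {y : Coord n} (hy : y ∈ Φ.target) (X Y Z : Coord n) :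
    fderiv ℝ (fun y => bilinCLM (pushProduct Φ star y)) y Z X Y
      = pushProduct Φ star y (pushProduct Φ star y X Y) Z := by
  obtain ⟨x, hx, rfl⟩ : ∃ x ∈ Φ.source, Φ x = y :=
    ⟨Φ.symm y, Φ.map_target hy, Φ.right_inv hy⟩
  exact fderiv_of_transformsProduct (P := fun y => bilinCLM (pushProduct Φ star y)) hg hHF hΦ hU hT
    (transformsProduct_pushProduct hΦ star) hx
    (((contDiffOn_pushProduct hΦ hU hHF.smooth).contDiffAt
      (Φ.open_target.mem_nhds hy)).differentiableAt (by simp)) X Y Z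

/-! Orthonormal diagonalisation of the product at a point. -/

theorem exists_perm_lt_iff (p : Fin n → Prop) :
    ∃ m ≤ n, ∃ σ : Equiv.Perm (Fin n), ∀ i, i.val < m ↔ p (σ i) := by
  classical
  have hm : Fintype.card {i // p i} ≤ n := by
    simpa using Fintype.card_subtype_le p
  refine ⟨Fintype.card {i // p i}, hm, ?_⟩
  have hcard : Fintype.card {i : Fin n // i.val < Fintype.card {i // p i}}
      = Fintype.card {i // p i} := by
    rw [Fintype.card_subtype, Fin.card_filter_val_lt, min_eq_right hm]
  let e := Fintype.equivOfCardEq hcard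
  exact ⟨e.extendSubtype, fun i => ⟨e.extendSubtype_mem i,
    fun h => by_contra fun hi => e.extendSubtype_not_mem i hi h⟩⟩

theorem isLinearMap_dotProduct_comp {L : Coord n → Coord n} (hL : IsLinearMap ℝ L) (v : Coord n) :
    IsLinearMap ℝ fun X => v ⬝ᵥ L X :=
  ⟨fun a b => by rw [hL.map_add, dotProduct_add],
    fun c a => by rw [hL.map_smul, dotProduct_smul]⟩

/-- An idempotent `u` is orthogonal to every other basis vector `v`: `u · v = (u ⋆ u) · v = u · (u ⋆
v) = 0`. The null basis vectors need not be orthogonal to each other, but any orthonormal basis of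
the complement of the idempotents can replace them. The permutation puts the null vectors first. -/
theorem exists_orthogonal_diagonal (b : Coord n →ₗ[ℝ] Coord n →ₗ[ℝ] Coord n)
    (frob : ∀ X Y Z, b X Y ⬝ᵥ Z = X ⬝ᵥ b Y Z) (e : Module.Basis (Fin n) ℝ (Coord n))
    (h0 : ∀ i j, i ≠ j → b (e i) (e j) = 0) (h1 : ∀ i, b (e i) (e i) = e i ∨ b (e i) (e i) = 0) :
    ∃ m ≤ n, ∃ (R : Matrix (Fin n) (Fin n) ℝ) (μ : Fin n → ℝ), R * Rᵀ = 1 ∧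
      (∀ i, i.val < m ↔ μ i = 0) ∧
      ∀ X Y i, (R *ᵥ b X Y) i = μ i * (R *ᵥ X) i * (R *ᵥ Y) i := by
  obtain ⟨m, hm, σ, hσ⟩ := exists_perm_lt_iff fun i => b (e i) (e i) = 0
  refine ⟨m, hm, ?_⟩
  let u := e.reindex σ.symm
  have hu : ∀ i, u i = e (σ i) := fun i => by simp [u]
  have u0 : ∀ i j, i ≠ j → b (u i) (u j) = 0 := fun i j hij => by
    rw [hu, hu]; exact h0 _ _ fun h => hij (σ.injective h)
  have ult : ∀ i, i.val < m → b (u i) (u i) = 0 := fun i hi => by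
    rw [hu]; exact (hσ i).1 hi
  have uge : ∀ i, ¬ i.val < m → b (u i) (u i) = u i := fun i hi => by
    rw [hu]; exact (h1 _).resolve_right fun h => hi ((hσ i).2 h)
  have orth : ∀ i j, i ≠ j → ¬ i.val < m → u i ⬝ᵥ u j = 0 := fun i j hij hi => by
    rw [← uge i hi, frob, u0 i j hij, dotProduct_zero]
  have hpos : ∀ i, 0 < u i ⬝ᵥ u i := fun i =>
    lt_of_le_of_ne (Finset.sum_nonneg fun k _ => mul_self_nonneg _)
      fun h => u.ne_zero i (dotProduct_self_eq_zero.1 h.symm)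
  let ν : Fin n → ℝ := fun i => (Real.sqrt (u i ⬝ᵥ u i))⁻¹
  have hν : ∀ i, ν i ≠ 0 := fun i => inv_ne_zero (Real.sqrt_pos.2 (hpos i)).ne'
  have hν2 : ∀ i, ν i * ν i * (u i ⬝ᵥ u i) = 1 := fun i => by
    have h : Real.sqrt (u i ⬝ᵥ u i) ≠ 0 := (Real.sqrt_pos.2 (hpos i)).ne'
    simp only [ν]
    field_simp
    exact (Real.sq_sqrt (hpos i).le).symm
  let v : Fin n → EuclideanSpace ℝ (Fin n) := fun i => WithLp.toLp 2 (ν i • u i)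
  have hinner : ∀ x y : EuclideanSpace ℝ (Fin n), inner ℝ x y = x.ofLp ⬝ᵥ y.ofLp := fun x y => by
    simp [EuclideanSpace.inner_eq_star_dotProduct, dotProduct_comm]
  -- Only the normalised idempotents are kept; the remaining slots are filled by extension to an
  -- orthonormal basis.
  have hv : Orthonormal ℝ (Set.domRestrict {i : Fin n | ¬ i.val < m} v) := by
    rw [orthonormal_iff_ite]
    rintro ⟨i, hi⟩ ⟨j, hj⟩
    change inner ℝ (v i) (v j) = _
    simp only [hinner, v, smul_dotProduct, dotProduct_smul, smul_eq_mul, Subtype.mk.injEq]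
    by_cases hij : i = j
    · subst hij
      rw [if_pos rfl, ← mul_assoc, hν2]
    · rw [if_neg hij, orth i j hij hi, mul_zero, mul_zero]
  obtain ⟨B, hB⟩ := hv.exists_orthonormalBasis_extension_of_card_eq (by simp)
  let f : Fin n → Coord n := fun i => (B i).ofLp
  have hf : ∀ i j, f i ⬝ᵥ f j = if i = j then 1 else 0 := fun i j => by
    rw [← hinner, orthonormal_iff_ite.1 B.orthonormal]
  have hfu : ∀ i, ¬ i.val < m → f i = ν i • u i := fun i hi => by
    simp [f, hB i hi, v]
  have hfu' : ∀ i k, ¬ k.val < m → i ≠ k → f i ⬝ᵥ u k = 0 := fun i k hk hik => by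
    have : f i ⬝ᵥ f k = 0 := by rw [hf, if_neg hik]
    rw [hfu k hk, dotProduct_smul, smul_eq_mul] at this
    exact (mul_eq_zero.1 this).resolve_left (hν k)
  -- For `f = νu` with `u` idempotent, `f ⋆ f = ν²u = νf`.
  let μ : Fin n → ℝ := fun i => if i.val < m then 0 else ν i
  have key : ∀ i X Y, f i ⬝ᵥ b X Y = μ i * (f i ⬝ᵥ X) * (f i ⬝ᵥ Y) := by
    intro i X Y
    have lin : ∀ c, IsLinearMap ℝ fun X => c * (f i ⬝ᵥ X) := fun c =>
      ⟨fun a b => by rw [dotProduct_add]; ring, fun r a => by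
        rw [dotProduct_smul, smul_eq_mul, smul_eq_mul]; ring⟩
    refine eq_of_eq_basis (f := fun X => f i ⬝ᵥ b X Y)
      (h := fun X => μ i * (f i ⬝ᵥ X) * (f i ⬝ᵥ Y))
      (isLinearMap_dotProduct_comp ⟨by simp, by simp⟩ _)
      (by simpa only [mul_right_comm] using lin (μ i * (f i ⬝ᵥ Y))) u (fun k => ?_) X
    refine eq_of_eq_basis (f := fun Y => f i ⬝ᵥ b (u k) Y)
      (h := fun Y => μ i * (f i ⬝ᵥ u k) * (f i ⬝ᵥ Y))
      (isLinearMap_dotProduct_comp ⟨by simp, by simp⟩ _) (lin _) u (fun l => ?_) Y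
    by_cases hi : i.val < m
    · simp only [μ, hi, if_true, zero_mul]
      by_cases hkl : k = l
      · subst hkl
        by_cases hk : k.val < m
        · rw [ult k hk, dotProduct_zero]
        · rw [uge k hk, hfu' i k hk fun h => hk (h ▸ hi)]
      · rw [u0 k l hkl, dotProduct_zero]
    · simp only [μ, hi, if_false, hfu i hi, smul_dotProduct, smul_eq_mul]
      by_cases hkl : k = l
      · subst hkl
        by_cases hik : i = k
        · subst hik
          rw [uge i hi]
          linear_combination -(ν i * (u i ⬝ᵥ u i)) * hν2 i
        · rw [orth i k hik hi]
          by_cases hk : k.val < m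
          · rw [ult k hk, dotProduct_zero]; ring
          · rw [uge k hk, orth i k hik hi]; ring
      · rw [u0 k l hkl, dotProduct_zero]
        by_cases hik : i = k
        · rw [orth i l (fun h => hkl (hik.symm.trans h)) hi]; ring
        · rw [orth i k hik hi]; ring
  refine ⟨Matrix.of f, μ, ?_, fun i => ?_, fun X Y i => key i X Y⟩
  · ext i j
    rw [Matrix.mul_apply, Matrix.one_apply, ← hf]
    rfl
  · simp only [μ]
    split_ifs with h
    · simp [h]
    · simp [h, hν i]

/-! Uniqueness for the equation `D_Z ⋆ (X, Y) = X ⋆ Y ⋆ Z`. -/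

open Set in
theorem eq_zero_of_norm_deriv_le {F : Type*} [NormedAddCommGroup F] [NormedSpace ℝ F]
    {D D' : ℝ → F} {K : ℝ} (hD : ∀ t ∈ Icc (0 : ℝ) 1, HasDerivAt D (D' t) t) (h0 : D 0 = 0)
    (hb : ∀ t ∈ Icc (0 : ℝ) 1, ‖D' t‖ ≤ K * ‖D t‖) : D 1 = 0 :=
  eq_zero_of_abs_deriv_le_mul_abs_self_of_eq_zero_right
    (fun t ht => (hD t ht).continuousAt.continuousWithinAt)
    (fun t ht => (hD t (Ico_subset_Icc_self ht)).hasDerivWithinAt) h0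
    (fun t ht => hb t (Ico_subset_Icc_self ht)) 1 (by simp)

section Uniqueness

variable {E : Type*} [NormedAddCommGroup E] [NormedSpace ℝ E]

/-- The Lipschitz bound for the quadratic right-hand side, from `A(A(X,Y),v) - C(C(X,Y),v) =
(A-C)(A(X,Y),v) + C((A-C)(X,Y),v)`. -/
theorem norm_square_sub_le {A C D : E →L[ℝ] E →L[ℝ] E} {M N : ℝ} (hA : ‖A‖ ≤ M) (hC : ‖C‖ ≤ N)
    (v : E) (hD : ∀ X Y, D X Y = A (A X Y) v - C (C X Y) v) :
    ‖D‖ ≤ (M + N) * ‖v‖ * ‖A - C‖ := by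
  have hM0 : 0 ≤ M := (norm_nonneg A).trans hA
  have hN0 : 0 ≤ N := (norm_nonneg C).trans hC
  refine ContinuousLinearMap.opNorm_le_bound₂ _ (by positivity) fun X Y => ?_
  have e1 : D X Y = (A - C) (A X Y) v + C ((A - C) X Y) v := by
    rw [hD]
    simp only [sub_apply, map_sub]
    abel
  rw [e1]
  have i1 : ‖A X Y‖ ≤ M * ‖X‖ * ‖Y‖ := (A.le_opNorm₂ X Y).trans (by gcongr)
  have i2 : ‖(A - C) X Y‖ ≤ ‖A - C‖ * ‖X‖ * ‖Y‖ := (A - C).le_opNorm₂ X Y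
  calc ‖(A - C) (A X Y) v + C ((A - C) X Y) v‖
      ≤ ‖A - C‖ * ‖A X Y‖ * ‖v‖ + ‖C‖ * ‖(A - C) X Y‖ * ‖v‖ :=
        (norm_add_le _ _).trans (add_le_add ((A - C).le_opNorm₂ _ _) (C.le_opNorm₂ _ _))
    _ ≤ ‖A - C‖ * (M * ‖X‖ * ‖Y‖) * ‖v‖ + N * (‖A - C‖ * ‖X‖ * ‖Y‖) * ‖v‖ := by gcongr
    _ = (M + N) * ‖v‖ * ‖A - C‖ * ‖X‖ * ‖Y‖ := by ring

-- On the segment from `q` to `y` both solutions are bounded by compactness, so their difference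
-- satisfies a linear differential inequality with zero initial value.
open Set in
theorem eqOn_of_fderiv_eq_mul {P S : E → E →L[ℝ] E →L[ℝ] E} {T : Set E} (hT : Convex ℝ T)
    (hP : ∀ y ∈ T, DifferentiableAt ℝ P y) (hS : ∀ y ∈ T, DifferentiableAt ℝ S y)
    (hP' : ∀ y ∈ T, ∀ X Y Z, fderiv ℝ P y Z X Y = P y (P y X Y) Z)
    (hS' : ∀ y ∈ T, ∀ X Y Z, fderiv ℝ S y Z X Y = S y (S y X Y) Z)
    {q : E} (hq : q ∈ T) (hPS : P q = S q) : EqOn P S T := by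
  intro y hy
  let γ : ℝ → E := fun t => q + t • (y - q)
  have hγT : ∀ t ∈ Icc (0 : ℝ) 1, γ t ∈ T := fun t ht => hT.add_smul_sub_mem hq hy ht
  have hγ : ∀ t, HasDerivAt γ (y - q) t := fun t =>
    (((hasDerivAt_id t).smul_const (y - q)).const_add q).congr_deriv (one_smul ℝ _)
  have hγc : Continuous γ := by fun_prop
  have bound : ∀ Q : E → E →L[ℝ] E →L[ℝ] E, (∀ y ∈ T, DifferentiableAt ℝ Q y) →
      ∃ M, ∀ t ∈ Icc (0 : ℝ) 1, ‖Q (γ t)‖ ≤ M := by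
    intro Q hQ
    have hc : ContinuousOn (fun t => ‖Q (γ t)‖) (Icc (0 : ℝ) 1) := fun t ht =>
      (ContinuousAt.norm (E := E →L[ℝ] E →L[ℝ] E) (ContinuousAt.comp (g := Q)
        (hQ _ (hγT t ht)).continuousAt hγc.continuousAt)).continuousWithinAt
    obtain ⟨M, hM⟩ := isCompact_Icc.exists_bound_of_continuousOn hc
    exact ⟨M, fun t ht => (le_abs_self _).trans (hM t ht)⟩
  obtain ⟨M, hM⟩ := bound P hP
  obtain ⟨N, hN⟩ := bound S hS
  have hD : ∀ t ∈ Icc (0 : ℝ) 1, HasDerivAt (fun t => P (γ t) - S (γ t))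
      (fderiv ℝ P (γ t) (y - q) - fderiv ℝ S (γ t) (y - q)) t := fun t ht =>
    (HasFDerivAt.comp_hasDerivAt (l := P) t (hP _ (hγT t ht)).hasFDerivAt (hγ t)).fun_sub
      (HasFDerivAt.comp_hasDerivAt (l := S) t (hS _ (hγT t ht)).hasFDerivAt (hγ t))
  have hz : P (γ 1) - S (γ 1) = 0 := eq_zero_of_norm_deriv_le (F := E →L[ℝ] E →L[ℝ] E) hD
    (by simp [γ, hPS]) fun t ht => norm_square_sub_le (hM t ht) (hN t ht) (y - q) fun X Y => by
      rw [sub_apply, sub_apply, hP' _ (hγT t ht), hS' _ (hγT t ht)]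
  have h1 : γ 1 = y := by simp [γ]
  rwa [h1, sub_eq_zero] at hz

end Uniqueness

theorem differentiableAt_normalLam (m : ℕ) {y : Coord n}
    (hy : ∀ j : Fin n, ¬ j.val < m → y j ≠ 0) (i : Fin n) :
    DifferentiableAt ℝ (normalLam m i) y ∧
      ∀ Z, fderiv ℝ (normalLam m i) y Z = normalLam m i y ^ 2 * Z i := by
  by_cases hi : i.val < m
  · have : normalLam (n := n) m i = fun _ => 0 := by ext; simp [normalLam, hi]
    rw [this]; simp
  · have : normalLam (n := n) m i = fun y => (fun s : ℝ => -(1 / s)) (y i) := by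
      ext; simp [normalLam, hi]
    have hd : HasDerivAt (fun s : ℝ => -(1 / s)) (-(-(y i ^ 2)⁻¹)) (y i) := by
      simpa using (hasDerivAt_inv (hy i hi)).fun_neg
    have h := hasFDerivAt_comp_coord i hd
    rw [this, h.fderiv]
    exact ⟨h.differentiableAt, fun Z => by simp⟩

theorem contDiffAt_normalLam (m : ℕ) {y : Coord n}
    (hy : ∀ j : Fin n, ¬ j.val < m → y j ≠ 0) (i : Fin n) : ContDiffAt ℝ ∞ (normalLam m i) y := by
  by_cases hi : i.val < m
  · have : normalLam (n := n) m i = fun _ => 0 := by ext; simp [normalLam, hi]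
    rw [this]; exact contDiffAt_const
  · have : normalLam (n := n) m i = fun y => -(1 / y i) := by
      ext; simp [normalLam, hi]
    rw [this]
    exact (contDiffAt_const.div (contDiff_apply ℝ ℝ i).contDiffAt (hy i hi)).neg

/-- For a diagonal product with each `λᵢ` a function of `xᵢ`, the structure equation is `λᵢ' = λᵢ²`,
solved by `0` and by `-1/xᵢ`. -/
theorem fderiv_normalForm (m : ℕ) {O : Set (Coord n)} (hO : IsOpen O)
    (hne : ∀ y ∈ O, ∀ j : Fin n, ¬ j.val < m → y j ≠ 0) {y : Coord n} (hyO : y ∈ O) :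
    DifferentiableAt ℝ (fun y => bilinCLM (diagProduct (normalLam (n := n) m) y)) y ∧
    ∀ X Y Z, fderiv ℝ (fun y => bilinCLM (diagProduct (normalLam (n := n) m) y)) y Z X Y
      = bilinCLM (diagProduct (normalLam m) y) (bilinCLM (diagProduct (normalLam m) y) X Y) Z := by
  have hy := hne y hyO
  have hXY : ∀ X Y : Coord n, HasFDerivAt
      (fun y => bilinCLM (diagProduct (normalLam (n := n) m) y) X Y)
      (ContinuousLinearMap.pi fun i => (Y i * X i) • fderiv ℝ (normalLam m i) y) y := by
    intro X Y
    refine hasFDerivAt_pi.2 fun i => ?_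
    have := (((differentiableAt_normalLam m hy i).1.hasFDerivAt).mul_const (X i)).mul_const (Y i)
    rw [smul_smul] at this
    exact this
  have hd : DifferentiableAt ℝ (fun y => bilinCLM (diagProduct (normalLam (n := n) m) y)) y := by
    have hs : ContDiffOn ℝ ∞ (fun y => bilinCLM (diagProduct (normalLam (n := n) m) y)) O := by
      rw [contDiffOn_clm_apply]
      intro X
      rw [contDiffOn_clm_apply]
      intro Y
      refine contDiffOn_pi.2 fun i => ?_
      have hl : ContDiffOn ℝ ∞ (normalLam m i) O := fun y hy =>
        (contDiffAt_normalLam m (hne y hy) i).contDiffWithinAt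
      exact (hl.mul contDiffOn_const).mul contDiffOn_const
    exact (hs.contDiffAt (hO.mem_nhds hyO)).differentiableAt (by simp)
  refine ⟨hd, fun X Y Z => ?_⟩
  have h := (hd.hasFDerivAt.clm_apply (hasFDerivAt_const X y)).clm_apply (hasFDerivAt_const Y y)
  have := congrArg (fun L : Coord n →L[ℝ] Coord n => L Z) (h.unique (hXY X Y))
  ext i
  have := congrFun this i
  simp at this
  rw [this, (differentiableAt_normalLam m hy i).2]
  simp
  ring

/-! The local normal form. -/

/-- The isometry `y ↦ R (y - q) + s` of Euclidean space, for an orthogonal matrix `R`. -/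
def affineIsometry (R : Matrix (Fin n) (Fin n) ℝ) (hR : R * Rᵀ = 1) (q s : Coord n) :
    Coord n ≃ₜ Coord n where
  toFun y := R *ᵥ (y - q) + s
  invFun y := Rᵀ *ᵥ (y - s) + q
  left_inv y := by
    simp [Matrix.mulVec_mulVec, mul_eq_one_comm.1 hR]
  right_inv y := by
    simp [Matrix.mulVec_mulVec, hR]
  continuous_toFun := by fun_prop
  continuous_invFun := by fun_prop

theorem hasFDerivAt_affine (R : Matrix (Fin n) (Fin n) ℝ) (q s y : Coord n) :
    HasFDerivAt (fun y => R *ᵥ (y - q) + s) (LinearMap.toContinuousLinearMap R.mulVecLin) y := by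
  have h := (LinearMap.toContinuousLinearMap R.mulVecLin).hasFDerivAt.comp y
    ((hasFDerivAt_id y).sub_const q)
  exact h.add_const s

theorem contDiff_affine (R : Matrix (Fin n) (Fin n) ℝ) (q s : Coord n) :
    ContDiff ℝ ∞ (fun y => R *ᵥ (y - q) + s) :=
  ((LinearMap.toContinuousLinearMap R.mulVecLin).contDiff.comp
    (contDiff_id.sub contDiff_const)).add contDiff_const

/-- Flat coordinates are fixed up to Euclidean motions: the rotation is used to diagonalise the
product at `p`, the translation to match its eigenvalues with `-1/xⱼ`. Uniqueness carries the
agreement from `p` to a ball. -/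
theorem exists_normalForm {U : Set (Coord n)} {g : TwoTensor n} {star : Product n}
    (hg : IsRiemannianMetric U g) (hflat : IsFlat U g) (hHF : IsHesseFrobenius U g star)
    (hss : IsSemiSimple U star) {p : Coord n} (hp : p ∈ U) :
    ∃ m ≤ n, ∃ Φ : OpenPartialHomeomorph (Coord n) (Coord n),
      IsCoordChange Φ ∧ p ∈ Φ.source ∧ Φ.source ⊆ U ∧ IsConnected Φ.target ∧
      (∀ y ∈ Φ.target, ∀ j : Fin n, ¬ j.val < m → y j ≠ 0) ∧
      TransformsMetric Φ g (euclid n) ∧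
      TransformsProduct Φ star (diagProduct (normalLam m)) := by
  obtain ⟨Φ₀, hΦ₀, hp₀, hU₀, hT₀⟩ := hflat p hp
  obtain ⟨e, he0, he1⟩ := hss p hp
  let b := pushProduct Φ₀ star (Φ₀ p)
  have hb : ∀ X Y, fderiv ℝ Φ₀ p (star p X Y) = b (fderiv ℝ Φ₀ p X) (fderiv ℝ Φ₀ p Y) :=
    transformsProduct_pushProduct hΦ₀ star p hp₀
  have hsurj := hΦ₀.fderiv_surjective hp₀
  have hinj : Function.Injective (fderiv ℝ Φ₀ p) :=
    Function.LeftInverse.injective (hΦ₀.fderiv_symm_fderiv hp₀)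
  have hfrob : ∀ X Y Z, b X Y ⬝ᵥ Z = X ⬝ᵥ b Y Z := by
    intro X Y Z
    obtain ⟨u, rfl⟩ := hsurj X
    obtain ⟨v, rfl⟩ := hsurj Y
    obtain ⟨w, rfl⟩ := hsurj Z
    have h1 := hT₀ p hp₀ (star p u v) w
    have h2 := hT₀ p hp₀ u (star p v w)
    simp only [euclid_apply, Matrix.one_mulVec] at h1 h2
    rw [← hb, ← hb, ← h1, ← h2, hHF.frobenius p hp]
  let D := LinearEquiv.ofBijective (fderiv ℝ Φ₀ p).toLinearMap ⟨hinj, hsurj⟩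
  have hD : ∀ X, D X = fderiv ℝ Φ₀ p X := fun _ => rfl
  obtain ⟨m, hm, R, μ, hR, hμ, hdiag⟩ := exists_orthogonal_diagonal b hfrob (e.map D)
    (fun i j hij => by
      rw [Module.Basis.map_apply, Module.Basis.map_apply, hD, hD, ← hb, he0 i j hij, map_zero])
    (fun i => by
      rw [Module.Basis.map_apply, hD, ← hb]
      exact (he1 i).imp (fun h => by rw [h]) fun h => by rw [h, map_zero])
  refine ⟨m, hm, ?_⟩
  -- The solution of `-1/sᵢ = μᵢ`; the coordinates with `μᵢ = 0` are arbitrary.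
  let s : Coord n := fun i => if i.val < m then 0 else -(1 / μ i)
  let A := affineIsometry R hR (Φ₀ p) s
  let Φ₁ := Φ₀.transHomeomorph A
  have hΦ₁ : IsCoordChange Φ₁ := by
    refine ⟨(contDiff_affine R (Φ₀ p) s).comp_contDiffOn hΦ₀.smooth, ?_⟩
    exact hΦ₀.smooth_symm.comp (contDiff_affine Rᵀ s (Φ₀ p)).contDiffOn fun y hy => hy
  have hΦ₁' : ∀ x ∈ Φ₀.source, ∀ X, fderiv ℝ Φ₁ x X = R *ᵥ fderiv ℝ Φ₀ x X := by
    intro x hx X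
    have h : HasFDerivAt Φ₁ _ x := (hasFDerivAt_affine R (Φ₀ p) s (Φ₀ x)).comp x
      (hΦ₀.differentiableAt hx).hasFDerivAt
    rw [h.fderiv]
    rfl
  have hT₁ : TransformsMetric Φ₁ g (euclid n) := by
    intro x hx X Y
    rw [hΦ₁' x hx, hΦ₁' x hx, hT₀ x hx]
    simp only [euclid_apply, Matrix.one_mulVec]
    rw [Matrix.dotProduct_mulVec, Matrix.vecMul_mulVec, mul_eq_one_comm.1 hR, Matrix.vecMul_one]
  have hs : Φ₁ p = s := by
    change R *ᵥ (Φ₀ p - Φ₀ p) + s = s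
    simp
  have hsne : ∀ j : Fin n, ¬ j.val < m → s j ≠ 0 := fun j hj => by
    simp only [s, hj, if_false]
    exact neg_ne_zero.2 (one_div_ne_zero fun h => hj ((hμ j).2 h))
  have hlam : ∀ i, normalLam m i s = μ i := by
    intro i
    by_cases hi : i.val < m
    · simp [normalLam, hi, (hμ i).1 hi]
    · simp [normalLam, hi, s]
  have hPs : bilinCLM (pushProduct Φ₁ star s) = bilinCLM (diagProduct (normalLam m) s) := by
    ext X Y i
    obtain ⟨u, rfl⟩ := hΦ₁.fderiv_surjective hp₀ X
    obtain ⟨v, rfl⟩ := hΦ₁.fderiv_surjective hp₀ Y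
    have h := transformsProduct_pushProduct hΦ₁ star p hp₀ u v
    rw [hs] at h
    rw [bilinCLM_apply, ← h, hΦ₁' p hp₀, hb, hdiag, bilinCLM_apply, diagProduct_apply, hlam,
      hΦ₁' p hp₀, hΦ₁' p hp₀]
  let N : Set (Coord n) := {y | ∀ j : Fin n, ¬ j.val < m → y j ≠ 0}
  have hN : IsOpen N := by
    have : N = ⋂ j : Fin n, {y | ¬ j.val < m → y j ≠ 0} := by ext; simp [N]
    rw [this]
    refine isOpen_iInter_of_finite fun j => ?_
    by_cases hj : j.val < m
    · simp [hj]
    · simpa [hj] using isOpen_ne.preimage (continuous_apply (A := fun _ => ℝ) j)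
  have hsT : s ∈ Φ₁.target ∩ N := ⟨hs ▸ Φ₁.map_source hp₀, hsne⟩
  -- A ball is convex, as uniqueness along segments requires, and it also makes the final coordinate
  -- range connected.
  obtain ⟨r, hr, hball⟩ := Metric.isOpen_iff.1 (Φ₁.open_target.inter hN) s hsT
  have hE := eqOn_of_fderiv_eq_mul (convex_ball s r)
    (P := fun y => bilinCLM (pushProduct Φ₁ star y))
    (S := fun y => bilinCLM (diagProduct (normalLam m) y))
    (fun y hy => ((contDiffOn_pushProduct hΦ₁ hU₀ hHF.smooth).contDiffAt
      (Φ₁.open_target.mem_nhds (hball hy).1)).differentiableAt (by simp))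
    (fun y hy => (fderiv_normalForm m hN (fun _ h => h) (hball hy).2).1)
    (fun y hy => fderiv_pushProduct hg hHF hΦ₁ hU₀ hT₁ (hball hy).1)
    (fun y hy => (fderiv_normalForm m hN (fun _ h => h) (hball hy).2).2)
    (Metric.mem_ball_self hr) hPs
  let Φ := (Φ₁.symm.restrOpen (Metric.ball s r) Metric.isOpen_ball).symm
  have htarget : Φ.target = Metric.ball s r := by
    change Φ₁.target ∩ Metric.ball s r = _
    exact Set.inter_eq_right.2 fun y hy => (hball hy).1
  have hsource : ∀ x ∈ Φ.source, x ∈ Φ₁.source := fun x hx => by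
    have h : Φ₁.symm (Φ x) = x := Φ.left_inv hx
    rw [← h]
    exact Φ₁.map_target (Φ.map_source hx).1
  have hcoe : (Φ : Coord n → Coord n) = Φ₁ := rfl
  refine ⟨Φ, ⟨hΦ₁.smooth.mono hsource, hΦ₁.smooth_symm.mono fun y hy => hy.1⟩, ?_,
    fun x hx => hU₀ (hsource x hx), ?_, ?_, fun x hx => hT₁ x (hsource x hx), ?_⟩
  · have h : s ∈ Φ.target := htarget ▸ Metric.mem_ball_self hr
    have h2 := Φ.map_target h
    have h3 : Φ.symm s = p := by
      change Φ₁.symm s = p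
      rw [← hs]
      exact Φ₁.left_inv hp₀
    rwa [h3] at h2
  · rw [htarget]
    exact ⟨⟨s, Metric.mem_ball_self hr⟩, (convex_ball s r).isPreconnected⟩
  · rw [htarget]
    exact fun y hy => (hball hy).2
  · intro x hx X Y
    have h1 := transformsProduct_pushProduct hΦ₁ star x (hsource x hx) X Y
    have h2 : Φ x ∈ Metric.ball s r := htarget ▸ Φ.map_source hx
    have h3 := congrArg (fun L : Coord n →L[ℝ] Coord n →L[ℝ] Coord n =>
      L (fderiv ℝ Φ x X) (fderiv ℝ Φ x Y)) (hE h2)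
    exact h1.trans h3

/-! The number of vanishing `λⱼ` is constant. -/

/-- The annihilator `{X | X ⋆ Y = 0 for all Y}` does not depend on coordinates. In the normal form
it is the kernel of the diagonal matrix of the `λⱼ`, which vanish exactly for the first `m` indices.
-/
theorem finrank_ker_eq {Φ : OpenPartialHomeomorph (Coord n) (Coord n)} (hΦ : IsCoordChange Φ)
    {star : Product n} {m : ℕ} (hm : m ≤ n)
    (hne : ∀ y ∈ Φ.target, ∀ j : Fin n, ¬ j.val < m → y j ≠ 0)
    (hT : TransformsProduct Φ star (diagProduct (normalLam m))) {x : Coord n}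
    (hx : x ∈ Φ.source) : Module.finrank ℝ (LinearMap.ker (star x)) = m := by
  have hsurj := hΦ.fderiv_surjective hx
  have hinj : Function.Injective (fderiv ℝ Φ x) :=
    Function.LeftInverse.injective (hΦ.fderiv_symm_fderiv hx)
  let D := LinearEquiv.ofBijective (fderiv ℝ Φ x).toLinearMap ⟨hinj, hsurj⟩
  have hD : ∀ X, D X = fderiv ℝ Φ x X := fun _ => rfl
  let d : Matrix (Fin n) (Fin n) ℝ := Matrix.diagonal fun i => normalLam m i (Φ x)
  have hker : LinearMap.ker (star x) = (LinearMap.ker (Matrix.toLin' d)).comap D.toLinearMap := by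
    ext X
    simp only [LinearMap.mem_ker, Submodule.mem_comap]
    constructor
    · intro h
      ext i
      have h1 := congrFun (hT x hx X (D.symm (ev i))) i
      rw [h, LinearMap.zero_apply, map_zero, ← hD, ← hD] at h1
      simpa [d, Matrix.mulVec_diagonal] using h1.symm
    · intro h
      refine LinearMap.ext fun Y => hinj ?_
      rw [hT x hx, LinearMap.zero_apply, map_zero]
      ext i
      have h1 := congrFun h i
      simp only [d, LinearEquiv.coe_coe, Matrix.toLin'_apply, Matrix.mulVec_diagonal, hD] at h1
      rw [diagProduct_apply, h1]
      simp
  have h1 : Module.finrank ℝ (LinearMap.ker (star x))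
      = Module.finrank ℝ (LinearMap.ker (Matrix.toLin' d)) := by
    rw [hker]
    exact (D.ofSubmodule' _).finrank_eq
  have h2 := LinearMap.finrank_range_add_finrank_ker (Matrix.toLin' d)
  have h3 : Module.finrank ℝ (LinearMap.range (Matrix.toLin' d)) = n - m := by
    have : d.rank = n - m := by
      rw [Matrix.rank_diagonal]
      have hiff : ∀ i : Fin n, normalLam m i (Φ x) ≠ 0 ↔ ¬ i.val < m := fun i => by
        by_cases hi : i.val < m
        · simp [normalLam, hi]
        · simpa [normalLam, hi] using hne _ (Φ.map_source hx) i hi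
      rw [Fintype.card_congr (Equiv.subtypeEquivRight hiff), Fintype.card_subtype_compl,
        Fintype.card_fin, Fintype.card_subtype, Fin.card_filter_val_lt, min_eq_right hm]
    rw [← this]
    rfl
  rw [h3, Module.finrank_fin_fun] at h2
  omega

end HesseFrobenius

/-! ### Globalisation of `m` and the main theorem. -/

open HesseFrobenius in
theorem mainTheorem1 (n : ℕ) (hn : 2 ≤ n) (U : Set (Coord n)) (hU : IsOpen U)
    (hconn : IsConnected U) (g : TwoTensor n) (star : Product n)
    (hg : IsRiemannianMetric U g) (hflat : IsFlat U g)
    (hHF : IsHesseFrobenius U g star) (hss : IsSemiSimple U star) :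
    ∃ m : ℕ, m ≤ n ∧ ∀ p ∈ U, ∃ Φ : OpenPartialHomeomorph (Coord n) (Coord n),
      IsCoordChange Φ ∧ p ∈ Φ.source ∧ Φ.source ⊆ U ∧ IsConnected Φ.target ∧
      -- the normal form of the structure in the new coordinates
      (∀ y ∈ Φ.target, ∀ j : Fin n, ¬ j.val < m → y j ≠ 0) ∧
      TransformsMetric Φ g (euclid n) ∧
      TransformsProduct Φ star (diagProduct (normalLam m)) ∧
      -- the general solution for the potential
      (∀ V : Coord n → ℝ,
        SolvesPotentialEq Φ.target (euclid n) (diagProduct (normalLam m)) V ↔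
          ∃ (c₀ : ℝ) (c : Fin n → ℝ) (d : ℝ), Set.EqOn V (swPotential m c₀ c d) Φ.target) ∧
      -- all members of the family are superintegrable
      (∀ (c₀ : ℝ) (c : Fin n → ℝ) (d : ℝ),
        IsSuperintegrable Φ.target (euclid n) (swPotential m c₀ c d)) ∧
      -- and, unless the product vanishes and the potential is constant, through integrals
      -- whose Killing tensors are solutions of the third step
      (∀ (c₀ : ℝ) (c : Fin n → ℝ) (d : ℝ), (m < n ∨ c₀ ≠ 0 ∨ c ≠ 0) →
        ∃ (K : Fin (2 * n - 2) → TwoTensor n) (W : Fin (2 * n - 2) → Coord n → ℝ),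
          (∀ k, IsCompatibleKilling Φ.target (euclid n) (diagProduct (normalLam m)) (K k)) ∧
          IsSuperintegrableWith Φ.target (euclid n) (swPotential m c₀ c d) K W) := by
  have hlocal : ∀ p ∈ U, ∃ V ∈ nhds p, ∀ x ∈ V,
      Module.finrank ℝ (LinearMap.ker (star x)) = Module.finrank ℝ (LinearMap.ker (star p)) := by
    intro p hp
    obtain ⟨m, hm, Φ, hΦ, hpΦ, -, -, hne, -, hT⟩ := exists_normalForm hg hflat hHF hss hp
    exact ⟨Φ.source, Φ.open_source.mem_nhds hpΦ, fun x hx => by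
      rw [finrank_ker_eq hΦ hm hne hT hx, finrank_ker_eq hΦ hm hne hT hpΦ]⟩
  -- A locally constant function is continuous into discrete `ℕ`, hence constant on the connected
  -- set `U`.
  have hcont : ContinuousOn (fun x => Module.finrank ℝ (LinearMap.ker (star x))) U := by
    intro p hp
    obtain ⟨V, hV, h⟩ := hlocal p hp
    exact ContinuousAt.continuousWithinAt
      (continuousAt_const.congr (Filter.eventually_of_mem hV fun x hx => (h x hx).symm))
  obtain ⟨p₀, hp₀⟩ := hconn.nonempty
  obtain ⟨m₀, hm₀, Φ₀, hΦ₀, hpΦ₀, -, -, hne₀, -, hT₀⟩ := exists_normalForm hg hflat hHF hss hp₀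
  refine ⟨m₀, hm₀, fun p hp => ?_⟩
  obtain ⟨m, hm, Φ, hΦ, hpΦ, hΦU, hΦc, hne, hT, hP⟩ := exists_normalForm hg hflat hHF hss hp
  obtain rfl : m = m₀ := by
    rw [← finrank_ker_eq hΦ hm hne hP hpΦ, ← finrank_ker_eq hΦ₀ hm₀ hne₀ hT₀ hpΦ₀]
    exact hconn.isPreconnected.constant hcont hp hp₀
  have compatible : ∀ (c₀ : ℝ) (c : Fin n → ℝ) (d : ℝ), (m < n ∨ c₀ ≠ 0 ∨ c ≠ 0) →
      ∃ (K : Fin (2 * n - 2) → TwoTensor n) (W : Fin (2 * n - 2) → Coord n → ℝ),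
        (∀ k, IsCompatibleKilling Φ.target (euclid n) (diagProduct (normalLam m)) (K k)) ∧
        IsSuperintegrableWith Φ.target (euclid n) (swPotential m c₀ c d) K W := by
    intro c₀ c d h
    rcases lt_or_eq_of_le hm with hlt | rfl
    · exact exists_isSuperintegrableWith_of_lt hlt hne Φ.open_target c₀ c d
    · exact exists_isSuperintegrableWith_of_ne_zero Φ.target Φ.open_target (by omega)
        (h.resolve_left (lt_irrefl _)) d
  refine ⟨Φ, hΦ, hpΦ, hΦU, hΦc, hne, hT, hP,
    solvesPotentialEq_normalLam_iff hn Φ.open_target hΦc.isPreconnected hne, ?_, compatible⟩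
  intro c₀ c d
  by_cases h : m < n ∨ c₀ ≠ 0 ∨ c ≠ 0
  · obtain ⟨K, W, -, hKW⟩ := compatible c₀ c d h
    exact ⟨K, W, hKW⟩
  · push Not at h
    obtain ⟨h1, rfl, rfl⟩ := h
    obtain rfl : m = n := le_antisymm hm h1
    exact isSuperintegrable_free Φ.target Φ.open_target (by omega) d
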